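/- **Setting.** Fix countably infinite sets of concept names, role names (split into transitive and non-transitive ones), individuals and variables. An interpretation $\mathcal I$ has a domain $\Delta^{\mathcal I}$, sets $A^{\mathcal I}\subseteq\Delta^{\mathcal I}$ (non-empty for finitely many concept names $A$ only) and relations $r^{\mathcal I}\subseteq\Delta^{\mathcal I}\times\Delta^{\mathcal I}$; individuals in the domain denote themselves. A TBox $\mathcal T$ is a finite set of concept inclusions in the normal form $\bigsqcap_i A_i\sqsubseteq\bigsqcup_j B_j$, $A\sqsubseteq\forall r.B$, $A\sqsubseteq\exists r.B$ (empty conjunctions and disjunctions are $\top$ and $\bot$); $\|\mathcal T\|$ is the number of symbols of its inclusions and of the transitivity declarations of its transitive roles. A model of the knowledge base $\mathcal K=(\mathcal T,\{A(a)\})$ is an interpretation $\mathcal I$ with $a\in A^{\mathcal I}$ that satisfies all inclusions of $\mathcal T$ and interprets every transitive role name by a transitive relation. A UCQ $Q$ is a finite set of Boolean conjunctive queries; $\mathcal I\models Q$ if one of them has a match in $\mathcal I$. For a concept name $F$, $\mathcal K\models_F Q$ means that every model $\mathcal I$ of $\mathcal K$ with $F^{\mathcal I}$ finite satisfies $Q$.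 Elements of $F^{\mathcal I}$ are called critical. **Elementary interpretations.** These are rooted interpretations over one transitive role $t$ (all other roles are empty). A *singleton* has one element and no edge, a *cycle* is a simple directed cycle (of length at least $1$), a *critical cluster* is strongly connected and contains a critical element. *Loop trees*: every rooted singleton is one; if $(\mathcal I,u)$ is a singleton or a cycle, without critical elements, and $(\mathcal I_1,u_1),\dots,(\mathcal I_n,u_n)$ are loop trees that share only critical elements with each other and with $\mathcal I$, then $\mathcal I\cup\bigcup_i\mathcal I_i$ with additional edges from $u$ to $u_1,\dots,u_n$ is one, with root $u$. *Elementary* are: rooted critical clusters and loop trees; $(\mathcal I\cup\mathcal I_1\cup\dots\cup\mathcal I_n,u)$ if $(\mathcal I,u)$ is a loop tree and the $(\mathcal I_i,u_i)$ are pairwise disjoint and elementary, where $u_i$ is the only element shared by $\mathcal I$ and $\mathcal I_i$ and is critical in both; $(\mathcal I\cup\mathcal J,u)$ if $(\mathcal I,u)$ is a critical cluster and $(\mathcal J,v)$ is elementary without cycles through $v$, where $v$ is the only element shared by $\mathcal I$ and $\mathcal J$. **Piecewise elementary interpretations.** $(\mathcal G,a)$ is piecewise elementary if its domain is partitioned into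 rooted pieces, each being a singleton or an elementary interpretation over some transitive role (which may depend on the piece), and the pieces form a (possibly infinite) tree such that: the root piece is a singleton with root $a$; for every two adjacent pieces there is exactly one edge from the parent piece to the child piece, and it leads to the root of the child; there are no other edges between different pieces; and for every transitive role name $t$, if a piece contains a $t$-edge or its root has an incoming $t$-edge, then no $t$-edge leads from this piece to another one. The piece size is the largest number of elements of a piece. The degree of an element is the number of its outgoing edges plus the number of its incoming edges (over all role names). **Quasi-unravelling.** Let $(\mathcal J,b)$ be rooted, over one role $t$. Let $\Delta_F$ be the union of its critical clusters, that is, of the strongly connected components that contain a critical element; let $K_b$ be the component of $b$ if it is critical, and $K_b=\{b\}$ otherwise. The quasi-unravelling of $(\mathcal J,b)$ has as elements those of $\Delta_F\cup\{b\}$ and the pairs $(K,p)$ where $K$ is $K_b$ or a critical cluster and $p$ is a non-empty path outside $\Delta_F\cup\{b\}$ that begins in a successor of an element of $K$. Each element of $\Delta_F\cup\{b\}$ is a copy of itself and $(K,pu)$ is a copy of $u$; copies keep their concept names. Its role $t$ is the transitive closure of the edges of $\mathcal J$ from $\Delta_F\cup\{b\}$ to $\Delta_F$, all $(u,(K,p))$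 with $u\in K$, all $((K,p),(K,pu))$, and all $((K,pu),v)$ with $(u,v)\in t^{\mathcal J}$, $v\in\Delta_F$. The quasi-unravelling $(\widetilde{\mathcal G},a)$ of a piecewise elementary $(\mathcal G,a)$ is obtained from the root piece by repeating exhaustively: for each new element $e'$ that is a copy of $e$ and each child piece $(\mathcal J,b)$ with an $r$-edge of $\mathcal G$ from $e$ to $b$, add a fresh copy of the quasi-unravelling of $(\mathcal J,b)$ with an $r$-edge from $e'$ to its root; finally all transitive roles are closed by transitivity. **Theorem.** Let $\mathcal K=(\mathcal T,\{A(a)\})$, let $F$ be a concept name and $Q$ a UCQ, and let $\ell$ be the number of concept names that appear in $\mathcal K$. If $\mathcal K\not\models_F Q$, then there is a piecewise elementary interpretation $(\mathcal G,a)$ of piece size at most $(\ell+1)^{(\ell+1)^2}$ and of degree at most $\|\mathcal T\|$ such that $\widetilde{\mathcal G}\models\mathcal K$ and $\widetilde{\mathcal G}\not\models Q$. -/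

import Mathlib

/-! ### Names, concept inclusions, knowledge bases -/

/-- Concept names (a countably infinite set). -/
abbrev ConceptName := ℕ

/-- Individuals (a countably infinite set). -/
abbrev Individual := ℕ

/-- Query variables (a countably infinite set). -/
abbrev QVar := ℕ

/-- Role names, split into transitive and non-transitive ones. -/
inductive RoleName where
  | trans (n : ℕ)
  | nontrans (n : ℕ)
deriving DecidableEq

/-- The role name is one of the transitive ones. -/
def RoleName.IsTransitive : RoleName → Prop
  | .trans _ => True
  | .nontrans _ => False

instance : DecidablePred RoleName.IsTransitive
  | .trans _ => isTrue trivial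
  | .nontrans _ => isFalse not_false

/-- Concept inclusions of the description logic S in normal form. -/
inductive ConceptInclusion where
  /-- `⨅ A ∈ L, A ⊑ ⨆ B ∈ R, B`; the empty conjunction is `⊤`, the empty disjunction is `⊥` -/
  | bool (L R : Finset ConceptName)
  /-- `A ⊑ ∀ r. B` -/
  | all (A : ConceptName) (r : RoleName) (B : ConceptName)
  /-- `A ⊑ ∃ r. B` -/
  | ex (A : ConceptName) (r : RoleName) (B : ConceptName)

namespace ConceptInclusion

/-- The concept names of a concept inclusion. -/
def concepts : ConceptInclusion → Finset ConceptName
  | bool L R => L ∪ R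
  | all A _ B => {A, B}
  | ex A _ B => {A, B}

/-- The role names of a concept inclusion. -/
def roles : ConceptInclusion → Finset RoleName
  | bool _ _ => ∅
  | all _ r _ => {r}
  | ex _ r _ => {r}

/-- The number of symbols of a concept inclusion. A conjunction or disjunction of `n ≥ 1` names has
`n` names and `n - 1` connectives; an empty one is the single symbol `⊤` or `⊥`. -/
def size : ConceptInclusion → ℕ
  | bool L R => max 1 (2 * L.card - 1) + 1 + max 1 (2 * R.card - 1)
  | all _ _ _ => 5
  | ex _ _ _ => 5

end ConceptInclusion

/-- A TBox is a finite set of (normalised) concept inclusions. -/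
abbrev TBox := Finset ConceptInclusion

/-- The concept names of a TBox. -/
def TBox.concepts (T : TBox) : Finset ConceptName := T.biUnion ConceptInclusion.concepts

/-- The role names of a TBox. -/
def TBox.roles (T : TBox) : Finset RoleName := T.biUnion ConceptInclusion.roles

/-- The total size of a TBox: the symbols of its concept inclusions, and two symbols for the
transitivity declaration of each transitive role name that it uses. -/
def TBox.size (T : TBox) : ℕ :=
  (∑ c ∈ T, c.size) + 2 * (T.roles.filter RoleName.IsTransitive).card

/-- Assertions `A(a)` and `r(a,b)`. -/
inductive Assertion where
  | concept (A : ConceptName) (a : Individual)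
  | role (r : RoleName) (a b : Individual)

/-- The concept names of an assertion. -/
def Assertion.concepts : Assertion → Finset ConceptName
  | concept A _ => {A}
  | role _ _ _ => ∅

/-- A knowledge base: a TBox and an ABox. -/
structure KB where
  tbox : TBox
  abox : Finset Assertion

/-- The concept names that appear in a knowledge base. -/
def KB.concepts (K : KB) : Finset ConceptName :=
  K.tbox.concepts ∪ K.abox.biUnion Assertion.concepts

/-! ### Interpretations -/

universe u

/-- Interpretations in which finitely many concept names occur. Under the standard name assumption
an individual that belongs to the domain denotes itself: `ind c = some d` says that the
individual `c` belongs to the domain, as its element `d`. -/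
structure Interp : Type (u + 1) where
  Dom : Type u
  ind : Individual → Option Dom
  ind_inj : ∀ c c' d, ind c = some d → ind c' = some d → c = c'
  conc : ConceptName → Set Dom
  rel : RoleName → Dom → Dom → Prop
  finite_occurring : {A | (conc A).Nonempty}.Finite

namespace Interp

/-- All transitive role names are interpreted by transitive relations. -/
def IsTransitive (I : Interp.{u}) : Prop :=
  ∀ t : RoleName, t.IsTransitive → ∀ x y z, I.rel t x y → I.rel t y z → I.rel t x z

/-- Satisfaction of a concept inclusion. -/
def SatInclusion (I : Interp.{u}) : ConceptInclusion → Prop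
  | .bool L R => ∀ x, (∀ A ∈ L, x ∈ I.conc A) → ∃ B ∈ R, x ∈ I.conc B
  | .all A r B => ∀ x ∈ I.conc A, ∀ y, I.rel r x y → y ∈ I.conc B
  | .ex A r B => ∀ x ∈ I.conc A, ∃ y, I.rel r x y ∧ y ∈ I.conc B

/-- Satisfaction of an assertion. -/
def SatAssertion (I : Interp.{u}) : Assertion → Prop
  | .concept A a => ∃ d, I.ind a = some d ∧ d ∈ I.conc A
  | .role r a b => ∃ d e, I.ind a = some d ∧ I.ind b = some e ∧ I.rel r d e

/-- The interpretation is a model of the knowledge base. -/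
def IsModel (I : Interp.{u}) (K : KB) : Prop :=
  I.IsTransitive ∧ (∀ c ∈ K.tbox, I.SatInclusion c) ∧ ∀ s ∈ K.abox, I.SatAssertion s

end Interp

/-! ### Queries and partially finite entailment -/

/-- Atoms `A(x)` and `r(x,y)`. -/
inductive Atom where
  | concept (A : ConceptName) (x : QVar)
  | role (r : RoleName) (x y : QVar)

/-- A Boolean conjunctive query: all variables are existentially quantified. -/
abbrev CQ := Finset Atom

/-- A union of conjunctive queries. -/
abbrev UCQ := Finset CQ

namespace Interp

/-- An atom holds under an assignment of the variables. -/
def SatAtom (I : Interp.{u}) (π : QVar → I.Dom) : Atom → Prop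
  | .concept A x => π x ∈ I.conc A
  | .role r x y => I.rel r (π x) (π y)

/-- The conjunctive query has a match. -/
def SatCQ (I : Interp.{u}) (q : CQ) : Prop :=
  ∃ π : QVar → I.Dom, ∀ α ∈ q, I.SatAtom π α

/-- Some disjunct has a match. -/
def SatUCQ (I : Interp.{u}) (Q : UCQ) : Prop := ∃ q ∈ Q, I.SatCQ q

end Interp

/-- `K` `F`-entails `Q`: every model of `K` in which `F` is finite satisfies `Q`. -/
def FEntails (K : KB) (F : ConceptName) (Q : UCQ) : Prop :=
  ∀ I : Interp.{u}, I.IsModel K → (I.conc F).Finite → I.SatUCQ Q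

/-! ### Interpretations over a single role, elementary interpretations -/

/-- An interpretation over one fixed role, whose domain is a set of elements of `Δ`. -/
structure RoleInterp (Δ : Type u) where
  dom : Set Δ
  conc : ConceptName → Set Δ
  edge : Δ → Δ → Prop
  conc_subset : ∀ A, conc A ⊆ dom
  edge_left : ∀ x y, edge x y → x ∈ dom
  edge_right : ∀ x y, edge x y → y ∈ dom

namespace RoleInterp

variable {Δ : Type u}

/-- `I ∪ ⋃ i, J i`. -/
def union (I : RoleInterp Δ) {n : ℕ} (J : Fin n → RoleInterp Δ) : RoleInterp Δ where
  dom := {x | x ∈ I.dom ∨ ∃ i, x ∈ (J i).dom}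
  conc A := {x | x ∈ I.conc A ∨ ∃ i, x ∈ (J i).conc A}
  edge x y := I.edge x y ∨ ∃ i, (J i).edge x y
  conc_subset A x hx := hx.imp (I.conc_subset A ·) fun ⟨i, hi⟩ => ⟨i, (J i).conc_subset A hi⟩
  edge_left x y h := h.imp (I.edge_left x y) fun ⟨i, hi⟩ => ⟨i, (J i).edge_left x y hi⟩
  edge_right x y h := h.imp (I.edge_right x y) fun ⟨i, hi⟩ => ⟨i, (J i).edge_right x y hi⟩

/-- The rooted interpretations `(J i, v i)` attached to the element `w` of `I`: the union, with
additional edges from `w` to all `v i`. -/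
def attach (I : RoleInterp Δ) (w : Δ) {n : ℕ} (J : Fin n → RoleInterp Δ) (v : Fin n → Δ) :
    RoleInterp Δ where
  dom := (I.union J).dom
  conc := (I.union J).conc
  edge x y := (I.union J).edge x y ∨ x = w ∧ w ∈ I.dom ∧ ∃ i, y = v i ∧ v i ∈ (J i).dom
  conc_subset := (I.union J).conc_subset
  edge_left _ _ h := h.elim ((I.union J).edge_left _ _) fun ⟨hx, hw, _⟩ => Or.inl (hx ▸ hw)
  edge_right x y h :=
    h.elim ((I.union J).edge_right x y) fun ⟨_, _, i, hy, hi⟩ => Or.inr ⟨i, hy ▸ hi⟩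

/-- The graph of `I` is the single isolated node `w`. -/
def IsSingleton (I : RoleInterp Δ) (w : Δ) : Prop :=
  I.dom = {w} ∧ ∀ x y, ¬ I.edge x y

/-- The graph of `I` is a simple directed cycle (of length `n + 1 ≥ 1`). -/
def IsCycle (I : RoleInterp Δ) : Prop :=
  ∃ (n : ℕ) (v : Fin (n + 1) → Δ), Function.Injective v ∧ I.dom = Set.range v ∧
    ∀ x y, I.edge x y ↔ ∃ i, x = v i ∧ y = v (i + 1)

/-- `y` is reachable from `x`. -/
def Reach (I : RoleInterp Δ) (x y : Δ) : Prop := Relation.ReflTransGen I.edge x y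

/-- `I` consists of a single strongly connected component and has a critical element, that is, an
element of `F`. -/
def IsCriticalCluster (F : ConceptName) (I : RoleInterp Δ) : Prop :=
  (∀ x ∈ I.dom, ∀ y ∈ I.dom, I.Reach x y) ∧ (I.conc F).Nonempty

/-- Loop trees. -/
inductive LoopTree (F : ConceptName) : RoleInterp Δ → Δ → Prop
  | singleton {I : RoleInterp Δ} {w : Δ} : I.IsSingleton w → LoopTree F I w
  | attach {I : RoleInterp Δ} {w : Δ} {n : ℕ} {J : Fin n → RoleInterp Δ} {v : Fin n → Δ} :
      (I.IsSingleton w ∨ (I.IsCycle ∧ w ∈ I.dom)) →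
      I.conc F = ∅ →
      (∀ i, LoopTree F (J i) (v i)) →
      (∀ i j, i ≠ j → (J i).dom ∩ (J j).dom ⊆ (J i).conc F ∩ (J j).conc F) →
      (∀ i, I.dom ∩ (J i).dom ⊆ I.conc F ∩ (J i).conc F) →
      LoopTree F (I.attach w J v) w

/-- Elementary interpretations. -/
inductive Elementary (F : ConceptName) : RoleInterp Δ → Δ → Prop
  | cluster {I : RoleInterp Δ} {w : Δ} : I.IsCriticalCluster F → w ∈ I.dom → Elementary F I w
  | loopTree {I : RoleInterp Δ} {w : Δ} : LoopTree F I w → Elementary F I w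
  | loopTree_union {I : RoleInterp Δ} {w : Δ} {n : ℕ} {J : Fin n → RoleInterp Δ}
      {v : Fin n → Δ} :
      LoopTree F I w →
      (∀ i, Elementary F (J i) (v i)) →
      (∀ i j, i ≠ j → Disjoint (J i).dom (J j).dom) →
      (∀ i, I.dom ∩ (J i).dom = {v i}) →
      (∀ i, v i ∈ I.conc F ∧ v i ∈ (J i).conc F) →
      Elementary F (I.union J) w
  | cluster_union {I J : RoleInterp Δ} {w v : Δ} :
      I.IsCriticalCluster F → w ∈ I.dom →
      Elementary F J v →
      (¬ Relation.TransGen J.edge v v) →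
      I.dom ∩ J.dom = {v} →
      Elementary F (I.union fun _ : Fin 1 => J) w

/-! ### Quasi-unravelling over a single role -/

/-- The strongly connected component of `x`. -/
def cluster (I : RoleInterp Δ) (x : Δ) : Set Δ := {y | y ∈ I.dom ∧ I.Reach x y ∧ I.Reach y x}

/-- The strongly connected component of `x` contains a critical element. -/
def InCritical (F : ConceptName) (I : RoleInterp Δ) (x : Δ) : Prop :=
  x ∈ I.dom ∧ (I.cluster x ∩ I.conc F).Nonempty

open Classical in
/-- The cluster of the root `b` if it is critical, and `{b}` otherwise. -/
noncomputable def rootCluster (F : ConceptName) (I : RoleInterp Δ) (b : Δ) : Set Δ :=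
  if I.InCritical F b then I.cluster b else {b}

/-- Elements of quasi-unravellings: the original elements, and the pairs `(K, p w)`, where `p w` is
the non-empty sequence with last entry `w`. -/
inductive QElem (Δ : Type u) : Type u
  | single (x : Δ)
  | copy (K : Set Δ) (p : List Δ) (w : Δ)

/-- The original element of which the given one is a copy. -/
def QElem.orig : QElem Δ → Δ
  | .single x => x
  | .copy _ _ w => w

/-- The domain of the quasi-unravelling of `(I, b)`. -/
def QDom (F : ConceptName) (I : RoleInterp Δ) (b : Δ) : QElem Δ → Prop
  | .single x => I.InCritical F x ∨ x = b
  | .copy K p w =>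
      (K = I.rootCluster F b ∨ ∃ x, I.InCritical F x ∧ K = I.cluster x) ∧
      (p ++ [w]).IsChain I.edge ∧
      (∀ y ∈ p ++ [w], y ∈ I.dom ∧ ¬ I.InCritical F y ∧ y ≠ b) ∧
      ∃ x ∈ K, ∃ y ∈ (p ++ [w]).head?, I.edge x y

/-- The relation whose transitive closure is the role in the quasi-unravelling of `(I, b)`. -/
inductive QStep (F : ConceptName) (I : RoleInterp Δ) (b : Δ) : QElem Δ → QElem Δ → Prop
  | single_single {x y : Δ} : (I.InCritical F x ∨ x = b) → I.InCritical F y → I.edge x y →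
      QStep F I b (.single x) (.single y)
  | single_copy {x : Δ} {K : Set Δ} {p : List Δ} {w : Δ} : QDom F I b (.copy K p w) → x ∈ K →
      QStep F I b (.single x) (.copy K p w)
  | copy_copy {K : Set Δ} {p : List Δ} {w y : Δ} : QDom F I b (.copy K p w) →
      QDom F I b (.copy K (p ++ [w]) y) → QStep F I b (.copy K p w) (.copy K (p ++ [w]) y)
  | copy_single {K : Set Δ} {p : List Δ} {w y : Δ} : QDom F I b (.copy K p w) →
      I.InCritical F y → I.edge w y → QStep F I b (.copy K p w) (.single y)

/-- The role of the quasi-unravelling of `(I, b)`. -/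
def QEdge (F : ConceptName) (I : RoleInterp Δ) (b : Δ) : QElem Δ → QElem Δ → Prop :=
  Relation.TransGen (QStep F I b)

end RoleInterp

/-! ### Piecewise elementary interpretations -/

/-- A decomposition that makes the rooted interpretation `(G, a)` piecewise single-role. The pieces
are given by the function that sends each element to the root of its piece. -/
structure PieceDecomposition (G : Interp.{u}) (a : G.Dom) where
  /-- the root of the piece of an element -/
  root : G.Dom → G.Dom
  /-- for the root `b` of a piece: `none` for a singleton piece, `some t` for a transitive piece,
  over the transitive role name `t` -/
  role : G.Dom → Option RoleName
  root_root : ∀ x, root (root x) = root x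
  /-- the root piece is a singleton interpretation with root `a` -/
  root_eq_iff : ∀ x, root x = a ↔ x = a
  role_root : role a = none
  eq_of_none : ∀ b, root b = b → role b = none → ∀ x, root x = b → x = b
  isTransitive_of_some : ∀ b, root b = b → ∀ t, role b = some t → t.IsTransitive
  /-- a singleton piece has no edges, a transitive piece over `t` has only `t`-edges -/
  role_of_rel : ∀ r x y, G.rel r x y → root x = root y → role (root x) = some r
  /-- edges between pieces lead to the root of a piece other than the root piece -/
  root_of_cross : ∀ r x y, G.rel r x y → root x ≠ root y → root y = y ∧ y ≠ a
  /-- exactly one edge comes from other pieces to each piece other than the root piece -/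
  existsUnique_parent : ∀ b, root b = b → b ≠ a →
    ∃! e : RoleName × G.Dom, G.rel e.1 e.2 b ∧ root e.2 ≠ b
  /-- each piece is reached from the root piece along finitely many edges between pieces -/
  reach : ∀ b, root b = b →
    Relation.ReflTransGen (fun c d => root c ≠ root d ∧ ∃ r x, root x = root c ∧ G.rel r x d) a b
  /-- if `t` is transitive and a `t`-edge leads from a piece to another one, then the former piece
  contains no `t`-edge and its root has no incoming `t`-edge -/
  separated : ∀ t : RoleName, t.IsTransitive → ∀ x y, G.rel t x y → root x ≠ root y →
    (∀ x' y', root x' = root x → root y' = root x → ¬ G.rel t x' y') ∧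
    ∀ z, ¬ G.rel t z (root x)

namespace PieceDecomposition

open RoleInterp

variable {G : Interp.{u}} {a : G.Dom}

/-- The piece with root `b`, as an interpretation over its role. -/
def piece (P : PieceDecomposition G a) (b : G.Dom) : RoleInterp G.Dom where
  dom := {x | P.root x = b}
  conc A := {x | P.root x = b ∧ x ∈ G.conc A}
  edge x y := P.root x = b ∧ P.root y = b ∧ ∃ t, P.role b = some t ∧ G.rel t x y
  conc_subset _ _ h := h.1
  edge_left _ _ h := h.1
  edge_right _ _ h := h.2.1

/-- The decomposition makes `(G, a)` piecewise elementary: each piece is a singleton or an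
elementary interpretation over a transitive role. -/
def IsElementary (P : PieceDecomposition G a) (F : ConceptName) : Prop :=
  ∀ b, P.root b = b → ∀ t, P.role b = some t → Elementary F (P.piece b) b

/-- `b` is the root of a piece, and an `r`-edge leads to it from the element `x` of another piece. -/
def Child (P : PieceDecomposition G a) (r : RoleName) (x b : G.Dom) : Prop :=
  P.root b = b ∧ P.root x ≠ b ∧ G.rel r x b

/-- The elements of the unravelling of `(G, a)`. The element `x :: l` is the element `x` of a fresh
copy of the quasi-unravelling of a piece; that copy has been added below the element `l`. -/
inductive IsCopy (P : PieceDecomposition G a) (F : ConceptName) : List (QElem G.Dom) → Prop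
  | root {x : QElem G.Dom} : QDom F (P.piece a) a x → IsCopy P F [x]
  | child {x y : QElem G.Dom} {l : List (QElem G.Dom)} {r : RoleName} {b : G.Dom} :
      IsCopy P F (x :: l) → P.Child r x.orig b → QDom F (P.piece b) b y → IsCopy P F (y :: x :: l)

/-- The edges of the unravelling, before closing by transitivity. -/
inductive CopyStep (P : PieceDecomposition G a) (F : ConceptName) (r : RoleName) :
    List (QElem G.Dom) → List (QElem G.Dom) → Prop
  /-- edges inside one copy of the quasi-unravelling of the piece with root `b` -/
  | inner {x y : QElem G.Dom} {l : List (QElem G.Dom)} {b : G.Dom} : P.root b = b →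
      P.role b = some r → QEdge F (P.piece b) b x y → CopyStep P F r (x :: l) (y :: l)
  /-- the edge to the root of a copy of the quasi-unravelling of the piece with root `b` -/
  | cross {x : QElem G.Dom} {l : List (QElem G.Dom)} {b : G.Dom} : P.Child r x.orig b →
      CopyStep P F r (x :: l) (.single b :: x :: l)

/-- The original element of which the given one is a copy. -/
def orig (P : PieceDecomposition G a) (F : ConceptName) :
    {l : List (QElem G.Dom) // P.IsCopy F l} → G.Dom
  | ⟨x :: _, _⟩ => x.orig
  | ⟨[], h⟩ => absurd h (fun h => nomatch h)

open Classical in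
/-- The (quasi-)unravelling of the piecewise single-role interpretation `(G, a)`. -/
noncomputable def unravelling (P : PieceDecomposition G a) (F : ConceptName) : Interp.{u} where
  Dom := {l : List (QElem G.Dom) // P.IsCopy F l}
  ind c := if G.ind c = some a then some ⟨[.single a], .root (Or.inr rfl)⟩ else none
  ind_inj c c' d h h' := by
    split_ifs at h h' with hc hc'
    exact G.ind_inj c c' a hc hc'
  conc A := {x | P.orig F x ∈ G.conc A}
  rel r x y :=
    if r.IsTransitive then
      Relation.TransGen (fun v w : {l // P.IsCopy F l} => P.CopyStep F r v.1 w.1) x y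
    else P.CopyStep F r x.1 y.1
  finite_occurring := G.finite_occurring.subset fun _ ⟨x, hx⟩ => ⟨P.orig F x, hx⟩

end PieceDecomposition

/-- The degree of an element in the multigraph of an interpretation: the number of outgoing edges
plus the number of incoming edges. -/
noncomputable def Interp.degree (G : Interp.{u}) (x : G.Dom) : ℕ∞ :=
  {e : RoleName × G.Dom | G.rel e.1 x e.2}.encard +
    {e : RoleName × G.Dom | G.rel e.1 e.2 x}.encard

/-!
Let `I` be a model of the knowledge base with finitely many critical elements and without a match of
the query. The tree of pieces is read off an ultrapower of `I`, in which elements are compared by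
bisimilarity of all finite depths (`Interp.ultraSim`), with steps along the role names of the TBox in
both directions and with the critical elements as nominals. Passing to the ultrapower keeps the model
property, the absence of matches and the finiteness of the set of critical elements, and has two
effects. Bisimilarity of all finite depths is itself a bisimulation (`Interp.ultraSim_forth`,
`Interp.ultraSim_back`). Moreover, infinite chains over a transitive role can be folded: among the
`t`-successors of `d` that see the same concept names as `d`, there is one that is seen again, up to
bisimilarity, from all its successors of this kind (`Interp.exists_recurrent_ultraSim`). The latter
holds in each coordinate for bisimilarity of a fixed depth, because that has finite index; this is
where finiteness of the set of critical elements is used. Both facts are recorded in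
`Interp.Saturation`.

A piece over `t` is built by induction on the number of concept names that its root `d` sees along `t`
(`RoleInterp.exists_isPiece`). If every successor of `d` sees fewer names, `d` gets one child for each
name that it sees. Otherwise, `d` gets a single child: a cycle through representatives of a final
cluster of successors that see the same names as `d`, and below it a child, which sees fewer names,
for each name that is not realized in the cluster. If the cluster contains a critical element, the
cycle is entered there and is a critical cluster. Such trees of cores are elementary
(`RoleInterp.CoreTree.elementary`); a branching critical element `w` is the union of its cluster with
a loop tree whose root is `w` without its concept names. Each child sees fewer names, so the size of a
piece is at most `(l + 1) ^ (2 * l + 1)`.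

Edges of pieces are only sound up to bisimilarity: an edge from `p` to `q` says that the label of `p`
has a successor bisimilar to the label of `q` (`Interp.Saturation.Sees`). This is what the
quasi-unravelling turns into a homomorphism (`RoleInterp.rel_image`): a path outside of the critical
clusters is mapped step by step, and the elements of critical clusters are determined by a nominal
(`RoleInterp.rel_of_inCritical`). Since all copies of an element are mapped to bisimilar elements, one
choice of child pieces serves all copies, and the homomorphisms of the pieces combine to one from the
whole unravelling to the ultrapower (`Blueprint.rel_hom`). Hence the unravelling has no match of the
query and satisfies the universal restrictions; existential restrictions hold because paths of pieces
lift to quasi-unravellings (`RoleInterp.exists_qEdge`).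
-/

/-! ### Bisimilarity of finite depth -/

namespace Interp

open Filter

/-- `k`-bisimilarity over the role names in `R`, with forward and backward steps, in which the
elements of `F` are nominals: they are `0`-bisimilar to themselves only. -/
def bisim (I : Interp.{u}) (R : Finset RoleName) (F : ConceptName) : ℕ → Setoid I.Dom
  | 0 => Setoid.ker fun d => (fun A => d ∈ I.conc A, fun c : I.conc F => c.1 = d)
  | k + 1 => Setoid.ker fun d => (Quotient.mk (bisim I R F k) d,
      fun r : R => {q | ∃ e, I.rel r d e ∧ Quotient.mk (bisim I R F k) e = q},
      fun r : R => {q | ∃ e, I.rel r e d ∧ Quotient.mk (bisim I R F k) e = q})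

section Bisim

variable {I : Interp.{u}} {R : Finset RoleName} {F : ConceptName}

lemma bisim_succ_le (k : ℕ) {x y : I.Dom} (h : I.bisim R F (k + 1) x y) : I.bisim R F k x y :=
  Quotient.exact (congrArg Prod.fst (h : (_ : _ × _) = _))

lemma bisim_mono {j k : ℕ} (hjk : j ≤ k) {x y : I.Dom} (h : I.bisim R F k x y) :
    I.bisim R F j x y := by
  induction k, hjk using Nat.le_induction with
  | base => exact h
  | succ k _ ih => exact ih (bisim_succ_le k h)

lemma bisim_zero_conc {x y : I.Dom} (h : I.bisim R F 0 x y) (A : ConceptName) :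
    x ∈ I.conc A ↔ y ∈ I.conc A :=
  iff_of_eq (congrFun (congrArg Prod.fst (h : (_ : _ × _) = _)) A)

lemma bisim_zero_eq {x y : I.Dom} (h : I.bisim R F 0 x y) (hx : x ∈ I.conc F) : x = y :=
  (iff_of_eq (congrFun (congrArg Prod.snd (h : (_ : _ × _) = _)) ⟨x, hx⟩)).1 rfl

lemma bisim_forth {k : ℕ} {x x' y : I.Dom} (h : I.bisim R F (k + 1) x x') {r : RoleName}
    (hr : r ∈ R) (hxy : I.rel r x y) : ∃ y', I.rel r x' y' ∧ I.bisim R F k y y' := by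
  have h1 := congrFun (congrArg (fun z => z.2.1) (h : (_ : _ × _ × _) = _)) ⟨r, hr⟩
  have h2 : Quotient.mk (I.bisim R F k) y ∈
      {q | ∃ e, I.rel r x e ∧ Quotient.mk (I.bisim R F k) e = q} := ⟨y, hxy, rfl⟩
  obtain ⟨y', hy', he⟩ := (Set.ext_iff.1 h1 _).1 h2
  exact ⟨y', hy', (I.bisim R F k).symm (Quotient.exact he)⟩

lemma bisim_back {k : ℕ} {x x' y : I.Dom} (h : I.bisim R F (k + 1) x x') {r : RoleName}
    (hr : r ∈ R) (hxy : I.rel r y x) : ∃ y', I.rel r y' x' ∧ I.bisim R F k y y' := by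
  have h1 := congrFun (congrArg (fun z => z.2.2) (h : (_ : _ × _ × _) = _)) ⟨r, hr⟩
  have h2 : Quotient.mk (I.bisim R F k) y ∈
      {q | ∃ e, I.rel r e x ∧ Quotient.mk (I.bisim R F k) e = q} := ⟨y, hxy, rfl⟩
  obtain ⟨y', hy', he⟩ := (Set.ext_iff.1 h1 _).1 h2
  exact ⟨y', hy', (I.bisim R F k).symm (Quotient.exact he)⟩

lemma finite_quotient_bisim (hF : (I.conc F).Finite) (k : ℕ) :
    Finite (Quotient (I.bisim R F k)) := by
  induction k with
  | zero =>
    have := hF.to_subtype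
    have := I.finite_occurring.to_subtype
    let f : I.Dom → ({A | (I.conc A).Nonempty} → Prop) × (I.conc F → Prop) :=
      fun d => (fun A => d ∈ I.conc A, fun c => c.1 = d)
    have hf : ∀ x y, I.bisim R F 0 x y ↔ f x = f y := by
      intro x y
      constructor
      · intro h
        have hs := congrArg Prod.snd (h : (_ : _ × _) = _)
        exact Prod.ext (funext fun A => propext (bisim_zero_conc h A)) hs
      · intro h
        refine Prod.ext (funext fun A => propext ?_) (congrArg Prod.snd h :)
        have key := fun hA => iff_of_eq (congrFun (congrArg Prod.fst h) ⟨A, hA⟩)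
        exact ⟨fun hx => (key ⟨x, hx⟩).1 hx, fun hy => (key ⟨y, hy⟩).2 hy⟩
    refine Finite.of_injective (Quotient.lift f fun x y h => (hf x y).1 h) ?_
    rintro ⟨x⟩ ⟨y⟩ h
    exact Quotient.sound ((hf x y).2 h)
  | succ k ih =>
    exact Finite.of_injective _ (Setoid.kerLift_injective _)

/-- One `y'` serves all depths up to `n` at which `x` and `x'` are bisimilar. -/
lemma bisim_forth_upto (n : ℕ) {x x' y : I.Dom} {r : RoleName} (hr : r ∈ R) (hxy : I.rel r x y) :
    ∃ y', ∀ k ≤ n, I.bisim R F (k + 1) x x' → I.rel r x' y' ∧ I.bisim R F k y y' := by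
  induction n with
  | zero =>
    by_cases h : I.bisim R F 1 x x'
    · obtain ⟨y', h1, h2⟩ := bisim_forth h hr hxy
      exact ⟨y', fun k hk _ => ⟨h1, bisim_mono hk h2⟩⟩
    · exact ⟨y, fun k hk h' => absurd (bisim_mono (by omega) h') h⟩
  | succ n ih =>
    by_cases h : I.bisim R F (n + 2) x x'
    · obtain ⟨y', h1, h2⟩ := bisim_forth h hr hxy
      exact ⟨y', fun k hk _ => ⟨h1, bisim_mono hk h2⟩⟩
    · obtain ⟨y', hy'⟩ := ih
      refine ⟨y', fun k hk h' => hy' k ?_ h'⟩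
      by_contra hkn
      exact h (bisim_mono (by omega) h')

lemma bisim_back_upto (n : ℕ) {x x' y : I.Dom} {r : RoleName} (hr : r ∈ R) (hxy : I.rel r y x) :
    ∃ y', ∀ k ≤ n, I.bisim R F (k + 1) x x' → I.rel r y' x' ∧ I.bisim R F k y y' := by
  induction n with
  | zero =>
    by_cases h : I.bisim R F 1 x x'
    · obtain ⟨y', h1, h2⟩ := bisim_back h hr hxy
      exact ⟨y', fun k hk _ => ⟨h1, bisim_mono hk h2⟩⟩
    · exact ⟨y, fun k hk h' => absurd (bisim_mono (by omega) h') h⟩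
  | succ n ih =>
    by_cases h : I.bisim R F (n + 2) x x'
    · obtain ⟨y', h1, h2⟩ := bisim_back h hr hxy
      exact ⟨y', fun k hk _ => ⟨h1, bisim_mono hk h2⟩⟩
    · obtain ⟨y', hy'⟩ := ih
      refine ⟨y', fun k hk h' => hy' k ?_ h'⟩
      by_contra hkn
      exact h (bisim_mono (by omega) h')

end Bisim

open Classical in
/-- The concept names in `E` that occur at `r`-successors of `d`. -/
noncomputable def seen (I : Interp.{u}) (r : RoleName) (E : Finset ConceptName) (d : I.Dom) :
    Finset ConceptName :=
  E.filter fun B => ∃ e, I.rel r d e ∧ e ∈ I.conc B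

lemma mem_seen {I : Interp.{u}} {r : RoleName} {E : Finset ConceptName} {d : I.Dom}
    {B : ConceptName} : B ∈ I.seen r E d ↔ B ∈ E ∧ ∃ e, I.rel r d e ∧ e ∈ I.conc B := by
  simp [seen]

lemma card_seen_le (I : Interp.{u}) (r : RoleName) (E : Finset ConceptName) (d : I.Dom) :
    (I.seen r E d).card ≤ E.card :=
  Finset.card_le_card fun _ hB => (mem_seen.1 hB).1

lemma seen_anti {I : Interp.{u}} (hI : I.IsTransitive) {t : RoleName} (ht : t.IsTransitive)
    {E : Finset ConceptName} {d e : I.Dom} (h : I.rel t d e) : I.seen t E e ⊆ I.seen t E d := by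
  intro B hB
  obtain ⟨hE, f, hf, hfB⟩ := mem_seen.1 hB
  exact mem_seen.2 ⟨hE, f, hI t ht _ _ _ h hf, hfB⟩

/-- Let `d` have a `t`-successor that sees the same concept names. In the preorder of those
successors, there is one that is, up to `k`-bisimilarity, contained in a final cluster. -/
lemma exists_recurrent_bisim {I : Interp.{u}} {R : Finset RoleName} {F : ConceptName}
    (hI : I.IsTransitive) (hF : (I.conc F).Finite) {t : RoleName} (ht : t.IsTransitive)
    (E : Finset ConceptName) (k : ℕ) (d : I.Dom)
    (hd : ∃ e, I.rel t d e ∧ I.seen t E e = I.seen t E d) :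
    ∃ u, (I.rel t d u ∧ I.seen t E u = I.seen t E d) ∧
      ∀ v, I.rel t u v → I.seen t E v = I.seen t E d →
        ∃ w, I.rel t v w ∧ I.bisim R F k w u := by
  have := finite_quotient_bisim (R := R) hF k
  -- `vis e` is the set of classes that `e` sees among the relevant elements
  let vis : I.Dom → Set (Quotient (I.bisim R F k)) := fun e =>
    {q | ∃ f, I.rel t e f ∧ I.seen t E f = I.seen t E d ∧ Quotient.mk _ f = q}
  have hvis : ∀ e f, I.rel t e f → vis f ⊆ vis e := by
    rintro e f hef q ⟨g, hg, hs, hq⟩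
    exact ⟨g, hI t ht _ _ _ hef hg, hs, hq⟩
  let D : Set I.Dom := {e | I.rel t d e ∧ I.seen t E e = I.seen t E d}
  obtain ⟨e, heD, hmin⟩ : ∃ e ∈ D, ∀ f ∈ D, (vis e).ncard ≤ (vis f).ncard := by
    obtain ⟨e, he, hm⟩ := WellFounded.has_min (measure fun e => (vis e).ncard).wf D hd
    exact ⟨e, he, fun f hf => not_lt.1 (hm f hf)⟩
  by_cases hsucc : ∃ u, I.rel t e u ∧ I.seen t E u = I.seen t E d
  · obtain ⟨u, heu, hu⟩ := hsucc
    have hdu := hI t ht _ _ _ heD.1 heu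
    refine ⟨u, ⟨hdu, hu⟩, fun v huv hv => ?_⟩
    have hvD : v ∈ D := ⟨hI t ht _ _ _ hdu huv, hv⟩
    have hev := hI t ht _ _ _ heu huv
    have heq : vis v = vis e := Set.eq_of_subset_of_ncard_le (hvis e v hev) (hmin v hvD)
    have : Quotient.mk _ u ∈ vis v := heq ▸ ⟨u, heu, hu, rfl⟩
    obtain ⟨w, hvw, _, hw⟩ := this
    exact ⟨w, hvw, Quotient.exact hw⟩
  · exact ⟨e, heD, fun v hev hv => absurd ⟨v, hev, hv⟩ hsucc⟩

/-! ### The ultrapower -/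

/-- The ultrapower with respect to a non-principal ultrafilter on `ℕ`. -/
noncomputable def ultrapower (I : Interp.{u}) : Interp.{u} where
  Dom := Germ (hyperfilter ℕ : Filter ℕ) I.Dom
  ind c := (I.ind c).map fun d : I.Dom => (d : Germ (hyperfilter ℕ : Filter ℕ) I.Dom)
  ind_inj c c' d h h' := by
    obtain ⟨x, hx, rfl⟩ := Option.map_eq_some_iff.1 h
    obtain ⟨y, hy, hyx⟩ := Option.map_eq_some_iff.1 h'
    rw [Germ.const_inj] at hyx
    exact I.ind_inj c c' x hx (hyx ▸ hy)
  conc A := {x | x.LiftPred (· ∈ I.conc A)}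
  rel r x y := x.LiftRel (I.rel r) y
  finite_occurring := I.finite_occurring.subset fun A ⟨x, hx⟩ => by
    induction x using Germ.inductionOn with
    | _ f =>
      obtain ⟨n, hn⟩ := (Germ.liftPred_coe.1 hx).exists
      exact ⟨f n, hn⟩

section Ultrapower

variable {I : Interp.{u}} {R : Finset RoleName} {F : ConceptName}

/-- The element of the ultrapower that is represented by a sequence. -/
noncomputable def germ (f : ℕ → I.Dom) : I.ultrapower.Dom := (f : Germ (hyperfilter ℕ : Filter ℕ) I.Dom)

lemma exists_germ (x : I.ultrapower.Dom) : ∃ f : ℕ → I.Dom, germ f = x :=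
  Quotient.exists_rep x

lemma germ_mem_conc {A : ConceptName} {f : ℕ → I.Dom} :
    germ f ∈ I.ultrapower.conc A ↔ ∀ᶠ n in hyperfilter ℕ, f n ∈ I.conc A := Iff.rfl

lemma rel_germ {r : RoleName} {f g : ℕ → I.Dom} :
    I.ultrapower.rel r (germ f) (germ g) ↔ ∀ᶠ n in hyperfilter ℕ, I.rel r (f n) (g n) := Iff.rfl

lemma germ_eq {f g : ℕ → I.Dom} :
    germ f = germ g ↔ ∀ᶠ n in hyperfilter ℕ, f n = g n := Germ.coe_eq

lemma seen_germ (r : RoleName) (E : Finset ConceptName) (f : ℕ → I.Dom) :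
    ∀ᶠ n in hyperfilter ℕ, I.seen r E (f n) = I.ultrapower.seen r E (germ f) := by
  have key : ∀ B ∈ E, ∀ᶠ n in hyperfilter ℕ, ((∃ e, I.rel r (f n) e ∧ e ∈ I.conc B) ↔
      ∃ e, I.ultrapower.rel r (germ f) e ∧ e ∈ I.ultrapower.conc B) := by
    intro B _
    by_cases h : ∃ e, I.ultrapower.rel r (germ f) e ∧ e ∈ I.ultrapower.conc B
    · obtain ⟨e, h1, h2⟩ := id h
      obtain ⟨g, rfl⟩ := exists_germ e
      filter_upwards [rel_germ.1 h1, germ_mem_conc.1 h2] with n hn1 hn2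
      exact ⟨fun _ => h, fun _ => ⟨g n, hn1, hn2⟩⟩
    · have : ∀ᶠ n in hyperfilter ℕ, ¬ ∃ e, I.rel r (f n) e ∧ e ∈ I.conc B := by
        rw [Ultrafilter.eventually_not]
        intro hev
        refine h ?_
        have hch : ∀ n, ∃ e, (∃ e, I.rel r (f n) e ∧ e ∈ I.conc B) →
            I.rel r (f n) e ∧ e ∈ I.conc B := fun n => by
          by_cases hn : ∃ e, I.rel r (f n) e ∧ e ∈ I.conc B
          · exact ⟨hn.choose, fun _ => hn.choose_spec⟩
          · exact ⟨f n, fun h => absurd h hn⟩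
        choose g hg using hch
        exact ⟨germ g, rel_germ.2 (hev.mono fun n hn => (hg n hn).1),
          germ_mem_conc.2 (hev.mono fun n hn => (hg n hn).2)⟩
      filter_upwards [this] with n hn
      exact ⟨fun h' => absurd h' hn, fun h' => absurd h' h⟩
  filter_upwards [(Filter.eventually_all_finset E).2 key] with n hn
  ext B
  rw [mem_seen, mem_seen]
  exact and_congr_right fun hB => hn B hB

lemma ultrapower_isModel {K : KB} (h : I.IsModel K) : I.ultrapower.IsModel K := by
  obtain ⟨htr, hT, hA⟩ := h
  refine ⟨?_, ?_, ?_⟩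
  · intro t ht x y z
    obtain ⟨f, rfl⟩ := exists_germ x
    obtain ⟨g, rfl⟩ := exists_germ y
    obtain ⟨k, rfl⟩ := exists_germ z
    intro h1 h2
    rw [rel_germ] at *
    filter_upwards [h1, h2] with n hn1 hn2 using htr t ht _ _ _ hn1 hn2
  · rintro (⟨L, S⟩ | ⟨A, r, B⟩ | ⟨A, r, B⟩) hc <;> have hsat := hT _ hc
    · intro x hx
      obtain ⟨f, rfl⟩ := exists_germ x
      have h1 : ∀ᶠ n in hyperfilter ℕ, ∀ A ∈ L, f n ∈ I.conc A :=
        (Filter.eventually_all_finset L).2 fun A hA => germ_mem_conc.1 (hx A hA)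
      have h2 : ∀ᶠ n in hyperfilter ℕ, ∃ B ∈ S, f n ∈ I.conc B :=
        h1.mono fun n hn => hsat (f n) hn
      by_contra hno
      push Not at hno
      have h3 : ∀ᶠ n in hyperfilter ℕ, ∀ B ∈ S, ¬ f n ∈ I.conc B :=
        (Filter.eventually_all_finset S).2 fun B hB =>
          Ultrafilter.eventually_not.2 (hno B hB)
      obtain ⟨n, ⟨B, hB, hn⟩, hn'⟩ := (h2.and h3).exists
      exact hn' B hB hn
    · intro x hx y hxy
      obtain ⟨f, rfl⟩ := exists_germ x
      obtain ⟨g, rfl⟩ := exists_germ y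
      rw [rel_germ] at hxy
      rw [germ_mem_conc] at *
      filter_upwards [hx, hxy] with n hn1 hn2 using hsat _ hn1 _ hn2
    · intro x hx
      obtain ⟨f, rfl⟩ := exists_germ x
      have hch : ∀ n, ∃ y, f n ∈ I.conc A → I.rel r (f n) y ∧ y ∈ I.conc B := fun n => by
        by_cases hn : f n ∈ I.conc A
        · obtain ⟨y, hy⟩ := hsat _ hn
          exact ⟨y, fun _ => hy⟩
        · exact ⟨f n, fun h => absurd h hn⟩
      choose g hg using hch
      exact ⟨germ g, rel_germ.2 ((germ_mem_conc.1 hx).mono fun n hn => (hg n hn).1),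
        germ_mem_conc.2 ((germ_mem_conc.1 hx).mono fun n hn => (hg n hn).2)⟩
  · rintro (⟨A, a⟩ | ⟨r, a, b⟩) hs
    · obtain ⟨d, hd, hdA⟩ := hA _ hs
      exact ⟨germ fun _ => d, by simp only [ultrapower, hd]; rfl,
        germ_mem_conc.2 (Eventually.of_forall fun _ => hdA)⟩
    · obtain ⟨d, e, hd, he, hde⟩ := hA _ hs
      exact ⟨germ fun _ => d, germ fun _ => e, by simp only [ultrapower, hd]; rfl,
        by simp only [ultrapower, he]; rfl, rel_germ.2 (Eventually.of_forall fun _ => hde)⟩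

lemma satUCQ_of_ultrapower {Q : UCQ} (h : I.ultrapower.SatUCQ Q) : I.SatUCQ Q := by
  obtain ⟨q, hq, π, hπ⟩ := h
  choose f hf using fun x => exists_germ (π x)
  have : ∀ᶠ n in hyperfilter ℕ, ∀ α ∈ q, I.SatAtom (fun x => f x n) α := by
    refine (Filter.eventually_all_finset q).2 fun α hα => ?_
    have h1 := hπ α hα
    cases α with
    | concept A x =>
      simp only [SatAtom, ← hf x] at h1
      exact germ_mem_conc.1 h1
    | role r x y =>
      simp only [SatAtom, ← hf x, ← hf y] at h1
      exact rel_germ.1 h1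
  obtain ⟨n, hn⟩ := this.exists
  exact ⟨q, hq, _, hn⟩

/-- Bisimilarity of all finite depths in the ultrapower. -/
def ultraSim (I : Interp.{u}) (R : Finset RoleName) (F : ConceptName)
    (x y : I.ultrapower.Dom) : Prop :=
  ∀ k, Germ.LiftRel (I.bisim R F k) x y

lemma ultraSim_germ {f g : ℕ → I.Dom} :
    I.ultraSim R F (germ f) (germ g) ↔ ∀ k, ∀ᶠ n in hyperfilter ℕ, I.bisim R F k (f n) (g n) :=
  Iff.rfl

lemma eventually_le (k : ℕ) : ∀ᶠ n in hyperfilter ℕ, k ≤ n :=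
  (Nat.hyperfilter_le_atTop) (eventually_ge_atTop k)

lemma ultraSim_forth {r : RoleName} (hr : r ∈ R) {x x' y : I.ultrapower.Dom}
    (h : I.ultraSim R F x x') (hxy : I.ultrapower.rel r x y) :
    ∃ y', I.ultrapower.rel r x' y' ∧ I.ultraSim R F y y' := by
  obtain ⟨f, rfl⟩ := exists_germ x
  obtain ⟨f', rfl⟩ := exists_germ x'
  obtain ⟨g, rfl⟩ := exists_germ y
  rw [ultraSim_germ] at h
  rw [rel_germ] at hxy
  have hch : ∀ n, ∃ y', I.rel r (f n) (g n) → ∀ k ≤ n, I.bisim R F (k + 1) (f n) (f' n) →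
      I.rel r (f' n) y' ∧ I.bisim R F k (g n) y' := fun n => by
    by_cases hn : I.rel r (f n) (g n)
    · obtain ⟨y', hy'⟩ := bisim_forth_upto (F := F) (x' := f' n) n hr hn
      exact ⟨y', fun _ => hy'⟩
    · exact ⟨f n, fun h => absurd h hn⟩
  choose g' hg' using hch
  refine ⟨germ g', rel_germ.2 ?_, ultraSim_germ.2 fun k => ?_⟩
  · filter_upwards [hxy, h 1] with n h1 h2 using (hg' n h1 0 (Nat.zero_le n) h2).1
  · filter_upwards [hxy, h (k + 1), eventually_le k] with n h1 h2 h3 using (hg' n h1 k h3 h2).2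

lemma ultraSim_back {r : RoleName} (hr : r ∈ R) {x x' y : I.ultrapower.Dom}
    (h : I.ultraSim R F x x') (hxy : I.ultrapower.rel r y x) :
    ∃ y', I.ultrapower.rel r y' x' ∧ I.ultraSim R F y y' := by
  obtain ⟨f, rfl⟩ := exists_germ x
  obtain ⟨f', rfl⟩ := exists_germ x'
  obtain ⟨g, rfl⟩ := exists_germ y
  rw [ultraSim_germ] at h
  rw [rel_germ] at hxy
  have hch : ∀ n, ∃ y', I.rel r (g n) (f n) → ∀ k ≤ n, I.bisim R F (k + 1) (f n) (f' n) →
      I.rel r y' (f' n) ∧ I.bisim R F k (g n) y' := fun n => by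
    by_cases hn : I.rel r (g n) (f n)
    · obtain ⟨y', hy'⟩ := bisim_back_upto (F := F) (x' := f' n) n hr hn
      exact ⟨y', fun _ => hy'⟩
    · exact ⟨f n, fun h => absurd h hn⟩
  choose g' hg' using hch
  refine ⟨germ g', rel_germ.2 ?_, ultraSim_germ.2 fun k => ?_⟩
  · filter_upwards [hxy, h 1] with n h1 h2 using (hg' n h1 0 (Nat.zero_le n) h2).1
  · filter_upwards [hxy, h (k + 1), eventually_le k] with n h1 h2 h3 using (hg' n h1 k h3 h2).2

/-- In the ultrapower, the final cluster of `exists_recurrent_bisim` is one up to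
`ultraSim`: its element is chosen, in the coordinate `k`, up to `k`-bisimilarity. -/
lemma exists_recurrent_ultraSim (hI : I.IsTransitive) (hF : (I.conc F).Finite) {t : RoleName}
    (ht : t.IsTransitive) (E : Finset ConceptName) (d : I.ultrapower.Dom)
    (hd : ∃ e, I.ultrapower.rel t d e ∧ I.ultrapower.seen t E e = I.ultrapower.seen t E d) :
    ∃ u, (I.ultrapower.rel t d u ∧ I.ultrapower.seen t E u = I.ultrapower.seen t E d) ∧
      ∀ v, I.ultrapower.rel t u v → I.ultrapower.seen t E v = I.ultrapower.seen t E d →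
        ∃ w, I.ultrapower.rel t v w ∧ I.ultraSim R F w u := by
  obtain ⟨f, rfl⟩ := exists_germ d
  obtain ⟨e, hde, hse⟩ := hd
  obtain ⟨g, rfl⟩ := exists_germ e
  rw [rel_germ] at hde
  have hD : ∀ᶠ n in hyperfilter ℕ, ∃ e, I.rel t (f n) e ∧ I.seen t E e = I.seen t E (f n) := by
    filter_upwards [hde, seen_germ t E f, seen_germ t E g] with n h1 h2 h3
    exact ⟨g n, h1, by rw [h2, h3, hse]⟩
  have hch : ∀ n, ∃ u, (∃ e, I.rel t (f n) e ∧ I.seen t E e = I.seen t E (f n)) →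
      (I.rel t (f n) u ∧ I.seen t E u = I.seen t E (f n)) ∧
      ∀ v, I.rel t u v → I.seen t E v = I.seen t E (f n) →
        ∃ w, I.rel t v w ∧ I.bisim R F n w u := fun n => by
    by_cases hn : ∃ e, I.rel t (f n) e ∧ I.seen t E e = I.seen t E (f n)
    · obtain ⟨u, hu⟩ := exists_recurrent_bisim (R := R) hI hF ht E n (f n) hn
      exact ⟨u, fun _ => hu⟩
    · exact ⟨f n, fun h => absurd h hn⟩
  choose u hu using hch
  refine ⟨germ u, ⟨rel_germ.2 (hD.mono fun n hn => (hu n hn).1.1), ?_⟩, ?_⟩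
  · obtain ⟨n, ⟨h1, h2⟩, h3⟩ := ((seen_germ t E f).and (seen_germ t E u)).and hD |>.exists
    rw [← h1, ← h2, (hu n h3).1.2]
  · intro v huv hsv
    obtain ⟨v, rfl⟩ := exists_germ v
    rw [rel_germ] at huv
    have hev : ∀ᶠ n in hyperfilter ℕ, ∃ w, I.rel t (v n) w ∧ I.bisim R F n w (u n) := by
      filter_upwards [hD, huv, seen_germ t E f, seen_germ t E v] with n h1 h2 h3 h4
      exact (hu n h1).2 (v n) h2 (by rw [h3, h4, hsv])
    have hch : ∀ n, ∃ w, (∃ w, I.rel t (v n) w ∧ I.bisim R F n w (u n)) →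
        I.rel t (v n) w ∧ I.bisim R F n w (u n) := fun n => by
      by_cases hn : ∃ w, I.rel t (v n) w ∧ I.bisim R F n w (u n)
      · exact ⟨hn.choose, fun _ => hn.choose_spec⟩
      · exact ⟨f n, fun h => absurd h hn⟩
    choose w hw using hch
    refine ⟨germ w, rel_germ.2 (hev.mono fun n hn => (hw n hn).1), ultraSim_germ.2 fun k => ?_⟩
    filter_upwards [hev, eventually_le k] with n h1 h2 using bisim_mono h2 (hw n h1).2

end Ultrapower

/-- A relation `sim` on an interpretation that is, up to the two-way steps along the role names in
`R`, indistinguishability by concept names and the nominals in `F`, together with the compactness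
property of modally saturated interpretations that is needed to fold infinite chains into cycles. -/
structure Saturation (I : Interp.{u}) (R : Finset RoleName) (F : ConceptName) where
  sim : I.Dom → I.Dom → Prop
  equiv : Equivalence sim
  conc_iff : ∀ {x y}, sim x y → ∀ A, x ∈ I.conc A ↔ y ∈ I.conc A
  eq_of_mem : ∀ {x y}, sim x y → x ∈ I.conc F → x = y
  forth : ∀ {r}, r ∈ R → ∀ {x x' y}, sim x x' → I.rel r x y → ∃ y', I.rel r x' y' ∧ sim y y'
  back : ∀ {r}, r ∈ R → ∀ {x x' y}, sim x x' → I.rel r y x → ∃ y', I.rel r y' x' ∧ sim y y'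
  recurrent : ∀ {t : RoleName}, t.IsTransitive → ∀ (E : Finset ConceptName) (d : I.Dom),
    (∃ e, I.rel t d e ∧ I.seen t E e = I.seen t E d) →
    ∃ u, (I.rel t d u ∧ I.seen t E u = I.seen t E d) ∧
      ∀ v, I.rel t u v → I.seen t E v = I.seen t E d → ∃ w, I.rel t v w ∧ sim w u

/-- The ultrapower of an interpretation with finitely many critical elements is saturated. -/
def ultrapowerSaturation {I : Interp.{u}} (hI : I.IsTransitive) (R : Finset RoleName)
    {F : ConceptName} (hF : (I.conc F).Finite) : I.ultrapower.Saturation R F where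
  sim := I.ultraSim R F
  equiv := by
    refine ⟨fun x => ?_, fun {x y} => ?_, fun {x y z} => ?_⟩
    · obtain ⟨f, rfl⟩ := exists_germ x
      exact ultraSim_germ.2 fun k => Eventually.of_forall fun n => (I.bisim R F k).refl _
    · obtain ⟨f, rfl⟩ := exists_germ x
      obtain ⟨g, rfl⟩ := exists_germ y
      exact fun h => ultraSim_germ.2 fun k =>
        (ultraSim_germ.1 h k).mono fun n hn => (I.bisim R F k).symm hn
    · obtain ⟨f, rfl⟩ := exists_germ x
      obtain ⟨g, rfl⟩ := exists_germ y
      obtain ⟨j, rfl⟩ := exists_germ z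
      exact fun h h' => ultraSim_germ.2 fun k => by
        filter_upwards [ultraSim_germ.1 h k, ultraSim_germ.1 h' k] with n h1 h2
        exact (I.bisim R F k).trans h1 h2
  conc_iff {x y} h A := by
    obtain ⟨f, rfl⟩ := exists_germ x
    obtain ⟨g, rfl⟩ := exists_germ y
    exact eventually_congr ((ultraSim_germ.1 h 0).mono fun n hn => bisim_zero_conc hn A)
  eq_of_mem {x y} h hx := by
    obtain ⟨f, rfl⟩ := exists_germ x
    obtain ⟨g, rfl⟩ := exists_germ y
    refine germ_eq.2 ?_
    filter_upwards [ultraSim_germ.1 h 0, germ_mem_conc.1 hx] with n h1 h2 using bisim_zero_eq h1 h2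
  forth hr _ _ _ h hxy := ultraSim_forth hr h hxy
  back hr _ _ _ h hxy := ultraSim_back hr h hxy
  recurrent ht E d hd := exists_recurrent_ultraSim hI hF ht E d hd

end Interp

/-! ### Assembling elementary interpretations from cores -/

namespace RoleInterp

variable {Δ Δ' : Type*} {F : ConceptName}

lemma eq_of_iff {I J : RoleInterp Δ} (hd : ∀ x, x ∈ I.dom ↔ x ∈ J.dom)
    (hc : ∀ A x, x ∈ I.conc A ↔ x ∈ J.conc A) (he : ∀ x y, I.edge x y ↔ J.edge x y) : I = J := by
  cases I
  cases J
  congr 1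
  · exact Set.ext hd
  · exact funext fun A => Set.ext (hc A)
  · exact funext fun x => funext fun y => propext (he x y)

/-- The image of an interpretation under a map of its elements. -/
def map (I : RoleInterp Δ) (f : Δ → Δ') : RoleInterp Δ' where
  dom := f '' I.dom
  conc A := f '' I.conc A
  edge x y := ∃ p q, I.edge p q ∧ f p = x ∧ f q = y
  conc_subset A := Set.image_mono (I.conc_subset A)
  edge_left := by
    rintro _ _ ⟨p, q, h, rfl, rfl⟩
    exact ⟨p, I.edge_left _ _ h, rfl⟩
  edge_right := by
    rintro _ _ ⟨p, q, h, rfl, rfl⟩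
    exact ⟨q, I.edge_right _ _ h, rfl⟩

/-- A core is what sits at the root of a piece that is built top down: a singleton or a cycle
without critical elements, or a critical cluster whose root is critical. -/
def IsCore (F : ConceptName) (I : RoleInterp Δ) (w : Δ) : Prop :=
  w ∈ I.dom ∧ ((I.conc F = ∅ ∧ (I.IsSingleton w ∨ I.IsCycle)) ∨
    (I.IsCriticalCluster F ∧ w ∈ I.conc F))

/-- Trees of cores: the children are pairwise disjoint trees of cores, and their roots are successors
of the root of the core. -/
inductive CoreTree (F : ConceptName) : RoleInterp Δ → Δ → Prop
  | attach {I : RoleInterp Δ} {w : Δ} {n : ℕ} {J : Fin n → RoleInterp Δ} {v : Fin n → Δ} :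
      I.IsCore F w → (∀ i, CoreTree F (J i) (v i)) →
      (∀ i j, i ≠ j → Disjoint (J i).dom (J j).dom) →
      (∀ i, Disjoint I.dom (J i).dom) → CoreTree F (I.attach w J v) w

lemma CoreTree.mem_dom {I : RoleInterp Δ} {w : Δ} (h : CoreTree F I w) : w ∈ I.dom := by
  cases h with
  | attach hI _ _ _ => exact Or.inl hI.1

lemma LoopTree.mem_dom {I : RoleInterp Δ} {w : Δ} (h : LoopTree F I w) : w ∈ I.dom := by
  cases h with
  | singleton h => exact h.1 ▸ rfl
  | attach h _ _ _ _ => exact Or.inl (h.elim (fun h => h.1 ▸ rfl) fun h => h.2)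

/-- A loop tree with pairwise disjoint elementary interpretations attached at critical elements. -/
def LoopTreeUnion (F : ConceptName) (M : RoleInterp Δ) (w : Δ) : Prop :=
  ∃ (L : RoleInterp Δ) (n : ℕ) (J : Fin n → RoleInterp Δ) (v : Fin n → Δ),
    LoopTree F L w ∧ (∀ i, Elementary F (J i) (v i)) ∧
    (∀ i j, i ≠ j → Disjoint (J i).dom (J j).dom) ∧ (∀ i, L.dom ∩ (J i).dom = {v i}) ∧
    (∀ i, v i ∈ L.conc F ∧ v i ∈ (J i).conc F) ∧ M = L.union J

lemma LoopTreeUnion.elementary {M : RoleInterp Δ} {w : Δ} (h : LoopTreeUnion F M w) :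
    Elementary F M w := by
  obtain ⟨L, n, J, v, h1, h2, h3, h4, h5, rfl⟩ := h
  exact .loopTree_union h1 h2 h3 h4 h5

/-- An elementary interpretation with a critical root is attached to a critical leaf. -/
lemma Elementary.loopTreeUnion {M : RoleInterp Δ} {w : Δ} (h : Elementary F M w)
    (hw : w ∈ M.conc F) : LoopTreeUnion F M w := by
  have hwd := M.conc_subset F hw
  let L : RoleInterp Δ :=
    { dom := {w}
      conc := fun A => {x | x = w ∧ w ∈ M.conc A}
      edge := fun _ _ => False
      conc_subset := fun A x hx => hx.1
      edge_left := fun _ _ h => h.elim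
      edge_right := fun _ _ h => h.elim }
  refine ⟨L, 1, fun _ => M, fun _ => w, .singleton ⟨rfl, fun _ _ h => h⟩, fun _ => h,
    fun i j hij => absurd (Subsingleton.elim i j) hij, fun _ => ?_, fun _ => ⟨⟨rfl, hw⟩, hw⟩, ?_⟩
  · exact Set.inter_eq_left.2 (Set.singleton_subset_iff.2 hwd)
  · refine eq_of_iff (fun x => ?_) (fun A x => ?_) (fun x y => ?_)
    · exact ⟨fun hx => Or.inr ⟨0, hx⟩, fun hx => hx.elim (fun (hx : x = w) => hx ▸ hwd)
        fun ⟨_, hx⟩ => hx⟩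
    · exact ⟨fun hx => Or.inr ⟨0, hx⟩, fun hx => hx.elim (fun hx => hx.1 ▸ hx.2)
        fun ⟨_, hx⟩ => hx⟩
    · exact ⟨fun hx => Or.inr ⟨0, hx⟩, fun hx => hx.elim (fun hx => hx.elim) fun ⟨_, hx⟩ => hx⟩

lemma loopTreeUnion_of_finite {ι : Type} [Finite ι] {M L : RoleInterp Δ} {w : Δ}
    {J : ι → RoleInterp Δ} {v : ι → Δ} (hL : LoopTree F L w) (hJ : ∀ i, Elementary F (J i) (v i))
    (hdis : ∀ i j, i ≠ j → Disjoint (J i).dom (J j).dom) (hi : ∀ i, L.dom ∩ (J i).dom = {v i})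
    (hcr : ∀ i, v i ∈ L.conc F ∧ v i ∈ (J i).conc F)
    (hd : ∀ x, x ∈ M.dom ↔ x ∈ L.dom ∨ ∃ i, x ∈ (J i).dom)
    (hc : ∀ A x, x ∈ M.conc A ↔ x ∈ L.conc A ∨ ∃ i, x ∈ (J i).conc A)
    (he : ∀ x y, M.edge x y ↔ L.edge x y ∨ ∃ i, (J i).edge x y) : LoopTreeUnion F M w := by
  obtain ⟨n, ⟨e⟩⟩ := Finite.exists_equiv_fin ι
  refine ⟨L, n, fun k => J (e.symm k), fun k => v (e.symm k), hL, fun _ => hJ _,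
    fun i j hij => hdis _ _ fun h => hij (e.symm.injective h), fun _ => hi _, fun _ => hcr _, ?_⟩
  refine eq_of_iff (fun x => (hd x).trans ?_) (fun A x => (hc A x).trans ?_)
    (fun x y => (he x y).trans ?_)
  all_goals exact or_congr_right ⟨fun ⟨i, hi⟩ => ⟨e i, by simpa using hi⟩,
    fun ⟨k, hk⟩ => ⟨e.symm k, hk⟩⟩

/-- Attaching to a core without critical elements. -/
lemma LoopTreeUnion.attach {I : RoleInterp Δ} {w : Δ} {n : ℕ} {J : Fin n → RoleInterp Δ}
    {v : Fin n → Δ} (hF : I.conc F = ∅) (hI : I.IsSingleton w ∨ (I.IsCycle ∧ w ∈ I.dom))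
    (hJ : ∀ i, LoopTreeUnion F (J i) (v i))
    (hdis : ∀ i j, i ≠ j → Disjoint (J i).dom (J j).dom)
    (hdI : ∀ i, Disjoint I.dom (J i).dom) : LoopTreeUnion F (I.attach w J v) w := by
  choose L m J' v' hL hel hd' hint hcr heq using hJ
  have hLJ : ∀ i, (L i).dom ⊆ (J i).dom := fun i x hx => by
    rw [heq i]
    exact Or.inl hx
  have hJJ : ∀ i k, (J' i k).dom ⊆ (J i).dom := fun i k x hx => by
    rw [heq i]
    exact Or.inr ⟨k, hx⟩
  have hempty : ∀ {s t s' t' : Set Δ}, Disjoint s t → s' ⊆ s → t' ⊆ t → s' ∩ t' = ∅ :=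
    fun h h1 h2 => Set.disjoint_iff_inter_eq_empty.1 (h.mono h1 h2)
  have hLT : LoopTree F (I.attach w L v) w := by
    refine .attach hI hF hL (fun i j hij => ?_) fun i => ?_
    · rw [hempty (hdis i j hij) (hLJ i) (hLJ j)]
      exact Set.empty_subset _
    · rw [hempty (hdI i) le_rfl (hLJ i)]
      exact Set.empty_subset _
  refine loopTreeUnion_of_finite (ι := Σ i, Fin (m i)) (J := fun s => J' s.1 s.2)
    (v := fun s => v' s.1 s.2) hLT (fun s => hel _ _) ?_ ?_ ?_ ?_ ?_ ?_
  · rintro ⟨i, k⟩ ⟨j, l⟩ hne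
    by_cases hij : i = j
    · subst hij
      exact hd' i k l fun h => hne (by rw [h])
    · exact (hdis i j hij).mono (hJJ i k) (hJJ j l)
  · rintro ⟨i, k⟩
    rw [← hint i k]
    ext x
    refine ⟨fun ⟨h1, h2⟩ => ⟨?_, h2⟩, fun ⟨h1, h2⟩ => ⟨Or.inr ⟨i, h1⟩, h2⟩⟩
    rcases h1 with h1 | ⟨j, h1⟩
    · exact absurd (hJJ i k h2) (Set.disjoint_left.1 (hdI i) h1)
    · by_cases hij : i = j
      · exact hij ▸ h1
      · exact absurd (hLJ j h1) (Set.disjoint_left.1 (hdis i j hij) (hJJ i k h2))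
  · rintro ⟨i, k⟩
    exact ⟨Or.inr ⟨i, (hcr i k).1⟩, (hcr i k).2⟩
  · intro x
    change (x ∈ I.dom ∨ ∃ i, x ∈ (J i).dom) ↔ (x ∈ I.dom ∨ ∃ i, x ∈ (L i).dom) ∨ _
    simp only [heq, union, Set.mem_ofPred_eq, exists_or, or_assoc, Sigma.exists]
  · intro A x
    change (x ∈ I.conc A ∨ ∃ i, x ∈ (J i).conc A) ↔ (x ∈ I.conc A ∨ ∃ i, x ∈ (L i).conc A) ∨ _
    simp only [heq, union, Set.mem_ofPred_eq, exists_or, or_assoc, Sigma.exists]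
  · intro x y
    change ((I.edge x y ∨ ∃ i, (J i).edge x y) ∨ x = w ∧ w ∈ I.dom ∧ ∃ i, y = v i ∧ v i ∈ (J i).dom)
      ↔ ((I.edge x y ∨ ∃ i, (L i).edge x y) ∨
        x = w ∧ w ∈ I.dom ∧ ∃ i, y = v i ∧ v i ∈ (L i).dom) ∨ _
    have h1 : ∀ i, v i ∈ (L i).dom := fun i => (hL i).mem_dom
    have h2 : ∀ i, v i ∈ (J i).dom := fun i => hLJ i (h1 i)
    simp only [h1, h2, and_true]
    simp only [heq, union, exists_or, Sigma.exists]
    rw [← or_assoc (a := I.edge x y), or_right_comm]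

/-- Trees of cores are elementary. The children of a critical core with root `w` are attached to a
separate singleton `w` without concept names, which is then merged with the core. -/
lemma CoreTree.loopTreeUnion {M : RoleInterp Δ} {w : Δ} (h : CoreTree F M w) :
    LoopTreeUnion F M w := by
  induction h with
  | @attach I w n J v hI hJ hdis hdI ih =>
    rcases hI with ⟨hw, ⟨hF, hI⟩ | ⟨hcl, hwF⟩⟩
    · exact .attach hF (hI.imp_right fun h => ⟨h, hw⟩) ih hdis hdI
    · let S : RoleInterp Δ :=
        { dom := {w}
          conc := fun _ => ∅
          edge := fun _ _ => False
          conc_subset := fun A x hx => hx.elim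
          edge_left := fun _ _ h => h.elim
          edge_right := fun _ _ h => h.elim }
      have hwJ : ∀ i, w ∉ (J i).dom := fun i => Set.disjoint_left.1 (hdI i) hw
      have hS : LoopTreeUnion F (S.attach w J v) w :=
        .attach rfl (Or.inl ⟨rfl, fun _ _ h => h⟩) ih hdis
          fun i => Set.disjoint_singleton_left.2 (hwJ i)
      have heq : I.attach w J v = I.union fun _ : Fin 1 => S.attach w J v := by
        refine eq_of_iff (fun x => ?_) (fun A x => ?_) (fun x y => ?_)
        · constructor
          · rintro (h | h)
            · exact Or.inl h
            · exact Or.inr ⟨0, Or.inr h⟩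
          · rintro (h | ⟨_, h | h⟩)
            · exact Or.inl h
            · exact Or.inl (h ▸ hw)
            · exact Or.inr h
        · constructor
          · rintro (h | h)
            · exact Or.inl h
            · exact Or.inr ⟨0, Or.inr h⟩
          · rintro (h | ⟨_, h | h⟩)
            · exact Or.inl h
            · exact h.elim
            · exact Or.inr h
        · constructor
          · rintro ((h | h) | ⟨h1, -, h2⟩)
            · exact Or.inl h
            · exact Or.inr ⟨0, Or.inl (Or.inr h)⟩
            · exact Or.inr ⟨0, Or.inr ⟨h1, rfl, h2⟩⟩
          · rintro (h | ⟨_, (h | h) | ⟨h1, -, h2⟩⟩)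
            · exact Or.inl (Or.inl h)
            · exact h.elim
            · exact Or.inl (Or.inr h)
            · exact Or.inr ⟨h1, hw, h2⟩
      refine Elementary.loopTreeUnion ?_ (Or.inl hwF)
      rw [heq]
      refine .cluster_union hcl hw hS.elementary ?_ ?_
      · intro hc
        obtain ⟨x, -, hx⟩ := Relation.TransGen.tail'_iff.1 hc
        rcases hx with (hx | ⟨i, hx⟩) | ⟨-, -, i, hx, hv⟩
        · exact hx
        · exact hwJ i ((J i).edge_right _ _ hx)
        · exact hwJ i (hx ▸ hv)
      · ext x
        constructor
        · rintro ⟨h1, h2 | ⟨i, h2⟩⟩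
          · exact h2
          · exact absurd h2 (Set.disjoint_left.1 (hdI i) h1)
        · rintro rfl
          exact ⟨hw, Or.inl rfl⟩

lemma CoreTree.elementary {M : RoleInterp Δ} {w : Δ} (h : CoreTree F M w) : Elementary F M w :=
  h.loopTreeUnion.elementary

lemma IsCore.map {I : RoleInterp Δ} {w : Δ} (h : I.IsCore F w) (f : Δ → Δ')
    (hf : Set.InjOn f I.dom) : (I.map f).IsCore F (f w) := by
  obtain ⟨hw, h⟩ := h
  refine ⟨⟨w, hw, rfl⟩, h.imp (fun ⟨hF, h⟩ => ⟨?_, h.imp (fun h => ?_) fun h => ?_⟩)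
    fun ⟨⟨h, hc⟩, hwF⟩ => ⟨⟨?_, ?_⟩, ⟨w, hwF, rfl⟩⟩⟩
  · simp [RoleInterp.map, hF]
  · refine ⟨by simp [RoleInterp.map, h.1], ?_⟩
    rintro _ _ ⟨p, q, hpq, -, -⟩
    exact h.2 p q hpq
  · obtain ⟨n, v, hv, hd, he⟩ := h
    have hvd : ∀ i, v i ∈ I.dom := fun i => hd ▸ ⟨i, rfl⟩
    refine ⟨n, f ∘ v, fun i j hij => hv (hf (hvd i) (hvd j) hij), ?_, fun x y => ?_⟩
    · change f '' I.dom = _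
      rw [hd, Set.range_comp]
    · constructor
      · rintro ⟨p, q, hpq, rfl, rfl⟩
        obtain ⟨i, rfl, rfl⟩ := (he _ _).1 hpq
        exact ⟨i, rfl, rfl⟩
      · rintro ⟨i, rfl, rfl⟩
        exact ⟨_, _, (he _ _).2 ⟨i, rfl, rfl⟩, rfl, rfl⟩
  · rintro _ ⟨p, hp, rfl⟩ _ ⟨q, hq, rfl⟩
    exact (h p hp q hq).lift f fun a b hab => ⟨a, b, hab, rfl, rfl⟩
  · exact hc.image f

lemma map_attach {I : RoleInterp Δ} {w : Δ} {n : ℕ} {J : Fin n → RoleInterp Δ} {v : Fin n → Δ}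
    (hw : w ∈ I.dom) (hv : ∀ i, v i ∈ (J i).dom) (f : Δ → Δ') :
    (I.attach w J v).map f = (I.map f).attach (f w) (fun i => (J i).map f) fun i => f (v i) := by
  refine eq_of_iff (fun x => ?_) (fun A x => ?_) (fun x y => ?_)
  · constructor
    · rintro ⟨p, hp | ⟨i, hp⟩, rfl⟩
      · exact Or.inl ⟨p, hp, rfl⟩
      · exact Or.inr ⟨i, p, hp, rfl⟩
    · rintro (⟨p, hp, rfl⟩ | ⟨i, p, hp, rfl⟩)
      · exact ⟨p, Or.inl hp, rfl⟩
      · exact ⟨p, Or.inr ⟨i, hp⟩, rfl⟩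
  · constructor
    · rintro ⟨p, hp | ⟨i, hp⟩, rfl⟩
      · exact Or.inl ⟨p, hp, rfl⟩
      · exact Or.inr ⟨i, p, hp, rfl⟩
    · rintro (⟨p, hp, rfl⟩ | ⟨i, p, hp, rfl⟩)
      · exact ⟨p, Or.inl hp, rfl⟩
      · exact ⟨p, Or.inr ⟨i, hp⟩, rfl⟩
  · constructor
    · rintro ⟨p, q, (h | ⟨i, h⟩) | ⟨rfl, -, i, rfl, -⟩, rfl, rfl⟩
      · exact Or.inl (Or.inl ⟨p, q, h, rfl, rfl⟩)
      · exact Or.inl (Or.inr ⟨i, p, q, h, rfl, rfl⟩)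
      · exact Or.inr ⟨rfl, ⟨_, hw, rfl⟩, i, rfl, ⟨_, hv i, rfl⟩⟩
    · rintro ((⟨p, q, h, rfl, rfl⟩ | ⟨i, p, q, h, rfl, rfl⟩) | ⟨rfl, -, i, rfl, -⟩)
      · exact ⟨p, q, Or.inl (Or.inl h), rfl, rfl⟩
      · exact ⟨p, q, Or.inl (Or.inr ⟨i, h⟩), rfl, rfl⟩
      · exact ⟨_, _, Or.inr ⟨rfl, hw, i, rfl, hv i⟩, rfl, rfl⟩

lemma disjoint_image_of_injOn {f : Δ → Δ'} {s t u : Set Δ} (hf : Set.InjOn f u) (hs : s ⊆ u)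
    (ht : t ⊆ u) (h : Disjoint s t) : Disjoint (f '' s) (f '' t) := by
  rw [Set.disjoint_iff_inter_eq_empty, ← hf.image_inter hs ht,
    Set.disjoint_iff_inter_eq_empty.1 h, Set.image_empty]

lemma CoreTree.map {M : RoleInterp Δ} {w : Δ} (h : CoreTree F M w) (f : Δ → Δ')
    (hf : Set.InjOn f M.dom) : CoreTree F (M.map f) (f w) := by
  induction h with
  | @attach I w n J v hI hJ hdis hdI ih =>
    have h1 : I.dom ⊆ (I.attach w J v).dom := fun x hx => Or.inl hx
    have h2 : ∀ i, (J i).dom ⊆ (I.attach w J v).dom := fun i x hx => Or.inr ⟨i, hx⟩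
    rw [map_attach hI.1 fun i => (hJ i).mem_dom]
    refine .attach (hI.map f (hf.mono h1)) (fun i => ih i (hf.mono (h2 i))) ?_ ?_
    · intro i j hij
      exact disjoint_image_of_injOn hf (h2 i) (h2 j) (hdis i j hij)
    · intro i
      exact disjoint_image_of_injOn hf h1 (h2 i) (hdI i)

end RoleInterp

/-! ### Pieces over one transitive role -/

namespace Interp.Saturation

variable {I : Interp.{u}} {R : Finset RoleName} {F : ConceptName}

/-- `x` has an `r`-successor that is indistinguishable from `y`. -/
def Sees (S : I.Saturation R F) (r : RoleName) (x y : I.Dom) : Prop :=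
  ∃ e, I.rel r x e ∧ S.sim e y

lemma Sees.of_rel {S : I.Saturation R F} {r : RoleName} {x y : I.Dom} (h : I.rel r x y) :
    S.Sees r x y := ⟨y, h, S.equiv.refl y⟩

lemma Sees.congr {S : I.Saturation R F} {r : RoleName} (hr : r ∈ R) {x x' y y' : I.Dom}
    (h : S.Sees r x y) (hx : S.sim x x') (hy : S.sim y y') : S.Sees r x' y' := by
  obtain ⟨e, hxe, he⟩ := h
  obtain ⟨e', hxe', hee'⟩ := S.forth hr hx hxe
  exact ⟨e', hxe', S.equiv.trans (S.equiv.symm hee') (S.equiv.trans he hy)⟩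

lemma Sees.trans {S : I.Saturation R F} (hI : I.IsTransitive) {t : RoleName} (ht : t.IsTransitive)
    (hr : t ∈ R) {x y z : I.Dom} (h : S.Sees t x y) (h' : S.Sees t y z) : S.Sees t x z := by
  obtain ⟨e, hxe, he⟩ := h
  obtain ⟨f, hef, hf⟩ := h'.congr hr (S.equiv.symm he) (S.equiv.refl z)
  exact ⟨f, hI t ht _ _ _ hxe hef, hf⟩

end Interp.Saturation

namespace RoleInterp

open Relation

/-- Positions in a piece: the path of child numbers that leads to a core, and the number of an
element of the core. -/
abbrev Pos := List ℕ × ℕ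

/-- The position of the root. -/
def rootPos : Pos := ([], 0)

/-- The positions in the child with number `i`. -/
def shift (i : ℕ) (p : Pos) : Pos := (i :: p.1, p.2)

lemma shift_injective (i : ℕ) : Function.Injective (shift i) := by
  rintro ⟨p, j⟩ ⟨q, l⟩ h
  simpa [shift] using h

/-- The core with the elements `0, …, k`: a cycle if `0 < k`, and a singleton otherwise. -/
def core {X : Type*} (conc : ConceptName → Set X) (k : ℕ) (c : ℕ → X) : RoleInterp Pos where
  dom := {p | p.1 = [] ∧ p.2 ≤ k}
  conc A := {p | (p.1 = [] ∧ p.2 ≤ k) ∧ c p.2 ∈ conc A}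
  edge p q := 0 < k ∧ p.1 = [] ∧ q.1 = [] ∧ (p.2 < k ∧ q.2 = p.2 + 1 ∨ p.2 = k ∧ q.2 = 0)
  conc_subset _ _ h := h.1
  edge_left := by
    rintro x y ⟨-, hx, -, ⟨h, -⟩ | ⟨h, -⟩⟩
    exacts [⟨hx, h.le⟩, ⟨hx, h.le⟩]
  edge_right := by
    rintro x y ⟨-, -, hy, ⟨h, h'⟩ | ⟨-, h⟩⟩
    exacts [⟨hy, by omega⟩, ⟨hy, by omega⟩]

section Core

variable {X : Type*} {conc : ConceptName → Set X} {k : ℕ} {c : ℕ → X}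

lemma core_transGen (hk : 0 < k) {i j : ℕ} (hi : i ≤ k) (hj : j ≤ k) :
    TransGen (core conc k c).edge ([], i) ([], j) := by
  have up : ∀ j ≤ k, ∀ i ≤ j, ReflTransGen (core conc k c).edge ([], i) ([], j) := by
    intro j hj i hij
    induction j, hij using Nat.le_induction with
    | base => exact .refl
    | succ j hij ih => exact (ih (by omega)).tail ⟨hk, rfl, rfl, Or.inl ⟨by simpa using hj, rfl⟩⟩
  have h0 : TransGen (core conc k c).edge ([], i) ([], 0) :=
    TransGen.tail' (up k le_rfl i hi) ⟨hk, rfl, rfl, Or.inr ⟨rfl, rfl⟩⟩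
  exact TransGen.trans_left h0 (up j hj 0 (Nat.zero_le j))

lemma core_isCore {F : ConceptName} (h : c 0 ∈ conc F ∨ ∀ j ≤ k, c j ∉ conc F) :
    (core conc k c).IsCore F rootPos := by
  refine ⟨⟨rfl, Nat.zero_le k⟩, ?_⟩
  rcases h with h | h
  · refine Or.inr ⟨⟨?_, rootPos, ⟨rfl, Nat.zero_le k⟩, h⟩, ⟨rfl, Nat.zero_le k⟩, h⟩
    rintro ⟨_, i⟩ ⟨rfl, hi⟩ ⟨_, j⟩ ⟨rfl, hj⟩
    rcases Nat.eq_zero_or_pos k with rfl | hk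
    · obtain rfl : i = 0 := Nat.le_zero.1 hi
      obtain rfl : j = 0 := Nat.le_zero.1 hj
      exact .refl
    · exact (core_transGen hk hi hj).to_reflTransGen
  · refine Or.inl ⟨Set.eq_empty_iff_forall_notMem.2 fun p hp => h _ hp.1.2 hp.2, ?_⟩
    rcases Nat.eq_zero_or_pos k with rfl | hk
    · refine Or.inl ⟨Set.ext fun p => ?_, fun x y h => absurd h.1 (lt_irrefl 0)⟩
      constructor
      · rintro ⟨h1, h2⟩
        exact Prod.ext h1 (Nat.le_zero.1 h2)
      · rintro rfl
        exact ⟨rfl, le_rfl⟩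
    · refine Or.inr ⟨k, fun i => ([], i), fun i j hij => Fin.ext (congrArg Prod.snd hij), ?_, ?_⟩
      · ext ⟨p, j⟩
        constructor
        · rintro ⟨rfl, hj⟩
          exact ⟨⟨j, Nat.lt_succ_of_le hj⟩, rfl⟩
        · rintro ⟨i, hi⟩
          obtain ⟨rfl, rfl⟩ := Prod.mk.inj hi
          exact ⟨rfl, Nat.lt_succ_iff.1 i.2⟩
      · rintro ⟨p, i⟩ ⟨q, j⟩
        constructor
        · rintro ⟨-, rfl, rfl, ⟨h1, h2⟩ | ⟨h1, h2⟩⟩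
          · dsimp only at h1 h2
            refine ⟨⟨i, by omega⟩, rfl, Prod.ext rfl ?_⟩
            exact h2.trans (Fin.val_add_one_of_lt (i := (⟨i, by omega⟩ : Fin (k + 1)))
              (Fin.lt_def.2 (by simpa using h1))).symm
          · dsimp only at h1 h2
            refine ⟨Fin.last k, Prod.ext rfl h1, Prod.ext rfl ?_⟩
            rw [Fin.last_add_one]
            exact h2
        · rintro ⟨l, h1, h2⟩
          obtain ⟨rfl, rfl⟩ := Prod.mk.inj h1
          obtain ⟨rfl, rfl⟩ := Prod.mk.inj h2
          refine ⟨hk, rfl, rfl, ?_⟩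
          have := Fin.val_add_one l
          split_ifs at this with hl
          · exact Or.inr ⟨by simp [hl], this⟩
          · refine Or.inl ⟨?_, this⟩
            have : l.val ≠ k := fun h => hl (Fin.ext h)
            have := l.2
            dsimp only
            omega

end Core

/-- `J` is a tree of cores over the transitive role name `t` whose elements are labelled by elements
of the saturated interpretation `I`; the root has the label `d`. Edges are sound up to `sim`, each
concept name in `E` that the label of an element sees is realized above the element, and the number
of elements is at most `N`. -/
structure IsPiece {I : Interp.{u}} {R : Finset RoleName} {F : ConceptName} (S : I.Saturation R F)
    (t : RoleName) (E : Finset ConceptName) (d : I.Dom) (N : ℕ) (J : RoleInterp Pos)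
    (lab : Pos → I.Dom) : Prop where
  coreTree : CoreTree F J rootPos
  lab_root : lab rootPos = d
  mem_conc : ∀ A p, p ∈ J.conc A ↔ p ∈ J.dom ∧ lab p ∈ I.conc A
  sees : ∀ p q, J.edge p q → S.Sees t (lab p) (lab q)
  witness : ∀ p ∈ J.dom, ∀ B ∈ I.seen t E (lab p), ∃ q, TransGen J.edge p q ∧ lab q ∈ I.conc B
  card : ∃ s : Finset Pos, J.dom ⊆ s ∧ s.card ≤ N
  out : ∀ p, {q | J.edge p q}.encard ≤ (E.card + 1 : ℕ)
  into : ∀ p, {q | J.edge q p}.encard ≤ 2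
  into_root : {q | J.edge q rootPos}.encard ≤ 1

variable {I : Interp.{u}} {R : Finset RoleName} {F : ConceptName} {S : I.Saturation R F}
  {t : RoleName} {E : Finset ConceptName} {N : ℕ}

section Combine

variable {n : ℕ}

/-- The labels after attaching pieces to a core. -/
def joinLab {X : Type*} (c : ℕ → X) (lab : Fin n → Pos → X) : Pos → X
  | ([], j) => c j
  | (i :: p, j) => if h : i < n then lab ⟨i, h⟩ (p, j) else c 0

lemma joinLab_shift {X : Type*} (c : ℕ → X) (lab : Fin n → Pos → X) (i : Fin n) (p : Pos) :
    joinLab c lab (shift i p) = lab i p := by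
  simp [joinLab, shift]

/-- The result of attaching pieces to a core. -/
def join (C : RoleInterp Pos) (J : Fin n → RoleInterp Pos) : RoleInterp Pos :=
  C.attach rootPos (fun i => (J i).map (shift i)) fun i => shift i rootPos

lemma join_edge {C : RoleInterp Pos} {J : Fin n → RoleInterp Pos} (hC : rootPos ∈ C.dom)
    (hJ : ∀ i, rootPos ∈ (J i).dom) {x y : Pos} : (join C J).edge x y ↔
      C.edge x y ∨ (∃ (i : Fin n) (p q : Pos), (J i).edge p q ∧ x = shift i p ∧ y = shift i q) ∨
      (x = rootPos ∧ ∃ i : Fin n, y = shift i rootPos) := by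
  constructor
  · rintro ((h | ⟨i, p, q, h, rfl, rfl⟩) | ⟨h1, -, i, h2, -⟩)
    · exact Or.inl h
    · exact Or.inr (Or.inl ⟨i, p, q, h, rfl, rfl⟩)
    · exact Or.inr (Or.inr ⟨h1, i, h2⟩)
  · rintro (h | ⟨i, p, q, h, rfl, rfl⟩ | ⟨rfl, i, rfl⟩)
    · exact Or.inl (Or.inl h)
    · exact Or.inl (Or.inr ⟨i, p, q, h, rfl, rfl⟩)
    · exact Or.inr ⟨rfl, hC, i, rfl, ⟨_, hJ i, rfl⟩⟩

/-- Attaching pieces to a core yields a piece. -/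
lemma isPiece_join {k : ℕ} {c : ℕ → I.Dom} {d : Fin n → I.Dom} {J : Fin n → RoleInterp Pos}
    {lab : Fin n → Pos → I.Dom} (hJ : ∀ i, IsPiece S t E (d i) N (J i) (lab i))
    (hcore : c 0 ∈ I.conc F ∨ ∀ j ≤ k, c j ∉ I.conc F)
    (hcyc : 0 < k → ∀ i ≤ k, ∀ j ≤ k, S.Sees t (c i) (c j))
    (hch : ∀ i, S.Sees t (c 0) (d i))
    (hwit : ∀ j ≤ k, ∀ B ∈ I.seen t E (c j), (0 < k ∧ ∃ i ≤ k, c i ∈ I.conc B) ∨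
      (∃ i, d i ∈ I.conc B) ∨ ∃ i, B ∈ I.seen t E (d i))
    (hn : n + (if 0 < k then 1 else 0) ≤ E.card + 1) :
    IsPiece S t E (c 0) (k + 1 + n * N) (join (core I.conc k c) J) (joinLab c lab) ∧
      (k = 0 → ∀ q, ¬ (join (core I.conc k c) J).edge q rootPos) := by
  have hCr : rootPos ∈ (core I.conc k c).dom := ⟨rfl, Nat.zero_le k⟩
  have hJr : ∀ i, rootPos ∈ (J i).dom := fun i => (hJ i).coreTree.mem_dom
  have hedge := @join_edge n (core I.conc k c) J hCr hJr
  have hCd : ∀ x ∈ (core I.conc k c).dom, ∀ i p, x ≠ shift i p := by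
    rintro x ⟨hx, -⟩ i p rfl
    exact List.cons_ne_nil _ _ hx
  have hroot : ∀ i p, rootPos ≠ shift i p := fun i p => hCd _ hCr i p
  have hfun : ∀ x, {y | (core I.conc k c).edge x y}.encard ≤ if 0 < k then 1 else 0 := by
    intro x
    split_ifs with hk
    · refine Set.encard_le_one_iff.2 ?_
      rintro a b ⟨-, -, ha, h1⟩ ⟨-, -, hb, h2⟩
      exact Prod.ext (ha.trans hb.symm) (by omega)
    · exact (Set.encard_eq_zero.2 (Set.eq_empty_iff_forall_notMem.2 fun y hy => hk hy.1)).le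
  have hinj : ∀ y, {x | (core I.conc k c).edge x y}.encard ≤ 1 := by
    intro y
    refine Set.encard_le_one_iff.2 ?_
    rintro a b ⟨-, ha, -, h1⟩ ⟨-, hb, -, h2⟩
    exact Prod.ext (ha.trans hb.symm) (by omega)
  have hinto : ∀ y ∈ (core I.conc k c).dom, ∀ x, (join (core I.conc k c) J).edge x y →
      (core I.conc k c).edge x y := by
    intro y hy x hx
    rcases hedge.1 hx with h | ⟨i, p, q, -, -, h⟩ | ⟨-, i, h⟩
    · exact h
    · exact absurd h (hCd y hy i q)
    · exact absurd h (hCd y hy i _)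
  have hlift : ∀ {i : Fin n} {p q : Pos}, TransGen (J i).edge p q →
      TransGen (join (core I.conc k c) J).edge (shift i p) (shift i q) := fun {i _ _} h =>
    TransGen.lift (shift i) (fun a b hab => hedge.2 (Or.inr (Or.inl ⟨i, a, b, hab, rfl, rfl⟩))) _ _ h
  have hcl : ∀ {p q : Pos}, TransGen (core I.conc k c).edge p q →
      TransGen (join (core I.conc k c) J).edge p q := fun h =>
    TransGen.mono (fun a b hab => hedge.2 (Or.inl hab)) _ _ h
  refine ⟨⟨?_, rfl, ?_, ?_, ?_, ?_, ?_, ?_, ?_⟩, ?_⟩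
  · refine .attach (core_isCore hcore) (fun i => (hJ i).coreTree.map _ (shift_injective i).injOn)
      ?_ ?_
    · intro i j hij
      refine Set.disjoint_left.2 ?_
      rintro _ ⟨p, -, rfl⟩ ⟨q, -, h⟩
      exact hij (Fin.ext (List.cons.inj (congrArg Prod.fst h)).1.symm)
    · intro i
      refine Set.disjoint_left.2 ?_
      rintro x hx ⟨p, -, h⟩
      exact hCd x hx i p h.symm
  · intro A x
    constructor
    · rintro (h | ⟨i, p, hp, rfl⟩)
      · obtain ⟨⟨h1, h2⟩, h3⟩ := h
        obtain ⟨_, j⟩ := x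
        obtain rfl : _ = [] := h1
        exact ⟨Or.inl ⟨rfl, h2⟩, h3⟩
      · obtain ⟨h1, h2⟩ := ((hJ i).mem_conc A p).1 hp
        exact ⟨Or.inr ⟨i, p, h1, rfl⟩, by rwa [joinLab_shift]⟩
    · rintro ⟨h | ⟨i, p, hp, rfl⟩, hA⟩
      · obtain ⟨_, j⟩ := x
        obtain ⟨rfl, h2⟩ := h
        exact Or.inl ⟨⟨rfl, h2⟩, hA⟩
      · rw [joinLab_shift] at hA
        exact Or.inr ⟨i, p, ((hJ i).mem_conc A p).2 ⟨hp, hA⟩, rfl⟩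
  · intro x y hxy
    rcases hedge.1 hxy with h | ⟨i, p, q, h, rfl, rfl⟩ | ⟨rfl, i, rfl⟩
    · have hx := (core I.conc k c).edge_left _ _ h
      have hy := (core I.conc k c).edge_right _ _ h
      obtain ⟨_, i⟩ := x
      obtain ⟨_, j⟩ := y
      obtain ⟨rfl, hi⟩ := hx
      obtain ⟨rfl, hj⟩ := hy
      exact hcyc h.1 i hi j hj
    · rw [joinLab_shift, joinLab_shift]
      exact (hJ i).sees p q h
    · rw [joinLab_shift, (hJ i).lab_root]
      exact hch i
  · rintro x (hx | ⟨i, p, hp, rfl⟩) B hB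
    · obtain ⟨_, j⟩ := x
      obtain ⟨rfl, hj⟩ := hx
      have hup : ∀ i : Fin n,
          TransGen (join (core I.conc k c) J).edge ([], j) (shift i rootPos) := by
        intro i
        have hlast : (join (core I.conc k c) J).edge rootPos (shift i rootPos) :=
          hedge.2 (Or.inr (Or.inr ⟨rfl, i, rfl⟩))
        rcases Nat.eq_zero_or_pos k with rfl | hk
        · obtain rfl : j = 0 := Nat.le_zero.1 hj
          exact .single hlast
        · exact (hcl (core_transGen hk hj (Nat.zero_le k))).tail hlast
      rcases hwit j hj B hB with ⟨hk, i, hi, hiB⟩ | ⟨i, hiB⟩ | ⟨i, hiB⟩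
      · exact ⟨([], i), hcl (core_transGen hk hj hi), hiB⟩
      · exact ⟨_, hup i, by rwa [joinLab_shift, (hJ i).lab_root]⟩
      · obtain ⟨q, hq, hqB⟩ := (hJ i).witness rootPos (hJr i) B (by rwa [(hJ i).lab_root])
        exact ⟨shift i q, (hup i).trans (hlift hq), by rwa [joinLab_shift]⟩
    · rw [joinLab_shift] at hB
      obtain ⟨q, hq, hqB⟩ := (hJ i).witness p hp B hB
      exact ⟨shift i q, hlift hq, by rwa [joinLab_shift]⟩
  · choose s hs hsN using fun i => (hJ i).card
    classical
    refine ⟨(Finset.range (k + 1)).image (fun j => (([], j) : Pos)) ∪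
      Finset.univ.biUnion fun i => (s i).image (shift i), ?_, ?_⟩
    · rintro x (hx | ⟨i, p, hp, rfl⟩)
      · obtain ⟨_, j⟩ := x
        obtain ⟨rfl, hj⟩ := hx
        refine Finset.mem_coe.2 (Finset.mem_union_left _ (Finset.mem_image.2 ⟨j, ?_, rfl⟩))
        exact Finset.mem_range.2 (Nat.lt_succ_of_le hj)
      · exact Finset.mem_coe.2 (Finset.mem_union_right _ (Finset.mem_biUnion.2
          ⟨i, Finset.mem_univ i, Finset.mem_image_of_mem _ (hs i hp)⟩))
    · refine (Finset.card_union_le _ _).trans (Nat.add_le_add ?_ ?_)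
      · exact Finset.card_image_le.trans (Finset.card_range _).le
      · refine (Finset.card_biUnion_le_card_mul _ _ N fun i _ =>
          Finset.card_image_le.trans (hsN i)).trans ?_
        simp
  · intro x
    have hle : {y | (join (core I.conc k c) J).edge x y}.encard ≤
        ((n + if 0 < k then 1 else 0 : ℕ) : ℕ∞) ∨ ∃ (i : Fin n) (p : Pos), x = shift i p := by
      by_cases hx : ∃ (i : Fin n) (p : Pos), x = shift i p
      · exact Or.inr hx
      left
      have hsub : {y | (join (core I.conc k c) J).edge x y} ⊆
          Set.range (fun i : Fin n => shift i rootPos) ∪ {y | (core I.conc k c).edge x y} := by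
        intro y hy
        rcases hedge.1 hy with h | ⟨i, p, q, h, rfl, rfl⟩ | ⟨rfl, i, rfl⟩
        · exact Or.inr h
        · exact absurd ⟨i, p, rfl⟩ hx
        · exact Or.inl ⟨i, rfl⟩
      refine (Set.encard_le_encard hsub).trans ((Set.encard_union_le _ _).trans ?_)
      rw [Nat.cast_add]
      refine add_le_add ?_ ((hfun x).trans (by split_ifs <;> simp))
      rw [← Set.image_univ]
      refine (Set.encard_image_le _ _).trans ?_
      simp
    rcases hle with hle | ⟨i, p, rfl⟩
    · exact hle.trans (by exact_mod_cast hn)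
    · refine le_trans (Set.encard_le_encard ?_) (((shift_injective i).encard_image
        {q | (J i).edge p q}).le.trans ((hJ i).out p))
      intro y hy
      rcases hedge.1 hy with h | ⟨i', p', q, h, h1, rfl⟩ | ⟨h, -⟩
      · exact absurd rfl (hCd _ ((core I.conc k c).edge_left _ _ h) i p)
      · obtain rfl : i = i' := Fin.ext (List.cons.inj (congrArg Prod.fst h1)).1
        obtain rfl := shift_injective i h1
        exact ⟨q, h, rfl⟩
      · exact absurd h.symm (hroot i p)
  · intro y
    by_cases hy : y ∈ (core I.conc k c).dom
    · exact (Set.encard_le_encard (hinto y hy)).trans ((hinj y).trans (by norm_num))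
    by_cases hy' : ∃ (i : Fin n) (q : Pos), y = shift i q
    · obtain ⟨i, q, rfl⟩ := hy'
      have hsub : ∀ x, (join (core I.conc k c) J).edge x (shift i q) →
          x ∈ shift i '' {p | (J i).edge p q} ∨ (x = rootPos ∧ q = rootPos) := by
        intro x hx
        rcases hedge.1 hx with h | ⟨i', p, q', h, rfl, h1⟩ | ⟨h, i', h1⟩
        · exact absurd ((core I.conc k c).edge_right _ _ h) hy
        · obtain rfl : i = i' := Fin.ext (List.cons.inj (congrArg Prod.fst h1)).1
          obtain rfl := shift_injective i h1
          exact Or.inl ⟨p, h, rfl⟩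
        · obtain rfl : i = i' := Fin.ext (List.cons.inj (congrArg Prod.fst h1)).1
          exact Or.inr ⟨h, shift_injective i h1⟩
      by_cases hq : q = rootPos
      · subst hq
        have hsub' : {x | (join (core I.conc k c) J).edge x (shift i rootPos)} ⊆
            shift i '' {p | (J i).edge p rootPos} ∪ {rootPos} :=
          fun x hx => (hsub x hx).imp_right And.left
        refine (Set.encard_le_encard hsub').trans ((Set.encard_union_le _ _).trans ?_)
        rw [(shift_injective i).encard_image, Set.encard_singleton, ← one_add_one_eq_two]
        gcongr
        exact (hJ i).into_root
      · refine le_trans (Set.encard_le_encard ?_) (((shift_injective i).encard_image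
          {p | (J i).edge p q}).le.trans ((hJ i).into q))
        exact fun x hx => (hsub x hx).resolve_right fun h => hq h.2
    · have : {x | (join (core I.conc k c) J).edge x y} = ∅ := by
        refine Set.eq_empty_iff_forall_notMem.2 fun x hx => ?_
        rcases hedge.1 hx with h | ⟨i, p, q, h, rfl, h1⟩ | ⟨h, i, h1⟩
        · exact hy ((core I.conc k c).edge_right _ _ h)
        · exact hy' ⟨i, _, h1⟩
        · exact hy' ⟨i, _, h1⟩
      rw [this]
      simp
  · exact (Set.encard_le_encard (hinto _ hCr)).trans (hinj _)
  · rintro rfl q hq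
    exact lt_irrefl 0 (hinto _ hCr q hq).1

end Combine

/-- A piece for an element `u` of a final cluster: the core is a cycle through representatives of all
concept names that are realized in the cluster; below the root of the core, there is a child for
each other concept name that `u` sees, and the child sees fewer concept names than `u`. -/
lemma exists_isPiece_final (hI : I.IsTransitive) (ht : t.IsTransitive) (htR : t ∈ R) {M : ℕ}
    (hM : 1 ≤ M) {u : I.Dom}
    (hpieces : ∀ e, (I.seen t E e).card < (I.seen t E u).card →
      ∃ J lab, IsPiece S t E e M J lab)
    (hu : ∀ v, I.rel t u v → I.seen t E v = I.seen t E u → S.Sees t v u)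
    (huF : u ∈ I.conc F ∨ ∀ v, I.rel t u v → I.seen t E v = I.seen t E u → v ∉ I.conc F) :
    ∃ J lab, IsPiece S t E u (1 + (I.seen t E u).card * M) J lab ∧
      ((∀ v, I.rel t u v → I.seen t E v ≠ I.seen t E u) → ∀ q, ¬ J.edge q rootPos) := by
  classical
  let W := I.seen t E u
  let Stay : ConceptName → Prop := fun B =>
    ∃ v, I.rel t u v ∧ v ∈ I.conc B ∧ I.seen t E v = I.seen t E u
  let W₁ := W.filter Stay
  let W₂ := W.filter fun B => ¬ Stay B
  have hcard : W₁.card + W₂.card = W.card := Finset.card_filter_add_card_filter_not _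
  have hWE : W.card ≤ E.card := I.card_seen_le t E u
  have h1 : ∀ j : Fin W₁.card, ∃ v, I.rel t u v ∧ v ∈ I.conc (W₁.equivFin.symm j).1 ∧
      I.seen t E v = I.seen t E u := fun j => (Finset.mem_filter.1 (W₁.equivFin.symm j).2).2
  choose m hum hmB hms using h1
  have h2 : ∀ i : Fin W₂.card, ∃ v, I.rel t u v ∧ v ∈ I.conc (W₂.equivFin.symm i).1 :=
    fun i => (Interp.mem_seen.1 (Finset.mem_filter.1 (W₂.equivFin.symm i).2).1).2
  choose d hud hdB using h2
  have h3 : ∀ i, ∃ J lab, IsPiece S t E (d i) M J lab := by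
    refine fun i => hpieces _ (Finset.card_lt_card ?_)
    refine lt_of_le_of_ne (Interp.seen_anti hI ht (hud i)) fun h => ?_
    exact (Finset.mem_filter.1 (W₂.equivFin.symm i).2).2 ⟨d i, hud i, hdB i, h⟩
  choose J lab hJ using h3
  let c : ℕ → I.Dom := fun j => if h : j - 1 < W₁.card ∧ 0 < j then m ⟨j - 1, h.1⟩ else u
  have hc0 : c 0 = u := by simp [c]
  have hc : ∀ j ≤ W₁.card, c j = u ∨ ∃ i, c j = m i := by
    intro j hj
    by_cases h : j - 1 < W₁.card ∧ 0 < j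
    · exact Or.inr ⟨_, dif_pos h⟩
    · exact Or.inl (dif_neg h)
  have hcm : ∀ i : Fin W₁.card, c (i + 1) = m i := fun i => by simp [c]
  have hseen : ∀ j ≤ W₁.card, I.seen t E (c j) = I.seen t E u := by
    intro j hj
    rcases hc j hj with h | ⟨i, h⟩
    · rw [h]
    · rw [h, hms]
  have hmu : ∀ i, S.Sees t (m i) u := fun i => hu _ (hum i) (hms i)
  have hfrom : 0 < W₁.card → ∀ j ≤ W₁.card, S.Sees t (c j) u := by
    intro hk j hj
    rcases hc j hj with h | ⟨i, h⟩
    · rw [h]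
      exact (Interp.Saturation.Sees.of_rel (hum ⟨0, hk⟩)).trans hI ht htR (hmu _)
    · exact h ▸ hmu i
  have hto : 0 < W₁.card → ∀ j ≤ W₁.card, S.Sees t u (c j) := by
    intro hk j hj
    rcases hc j hj with h | ⟨i, h⟩
    · exact h ▸ (Interp.Saturation.Sees.of_rel (hum ⟨0, hk⟩)).trans hI ht htR (hmu _)
    · exact h ▸ .of_rel (hum i)
  have hcoreF : c 0 ∈ I.conc F ∨ ∀ j ≤ W₁.card, c j ∉ I.conc F := by
    by_cases huF' : u ∈ I.conc F
    · exact Or.inl (hc0.symm ▸ huF')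
    · refine Or.inr fun j hj => ?_
      rcases hc j hj with h | ⟨i, h⟩
      · rwa [h]
      · rw [h]
        exact (huF.resolve_left huF') _ (hum i) (hms i)
  have hwit : ∀ j ≤ W₁.card, ∀ B ∈ I.seen t E (c j),
      (0 < W₁.card ∧ ∃ i ≤ W₁.card, c i ∈ I.conc B) ∨
      (∃ i, d i ∈ I.conc B) ∨ ∃ i, B ∈ I.seen t E (d i) := by
    intro j hj B hB
    rw [hseen j hj] at hB
    by_cases hst : Stay B
    · have hB1 : B ∈ W₁ := Finset.mem_filter.2 ⟨hB, hst⟩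
      refine Or.inl ⟨Finset.card_pos.2 ⟨B, hB1⟩, _, Nat.succ_le_of_lt (W₁.equivFin ⟨B, hB1⟩).2, ?_⟩
      rw [Nat.succ_eq_add_one, hcm]
      simpa using hmB (W₁.equivFin ⟨B, hB1⟩)
    · have hB2 : B ∈ W₂ := Finset.mem_filter.2 ⟨hB, hst⟩
      exact Or.inr (Or.inl ⟨W₂.equivFin ⟨B, hB2⟩, by simpa using hdB (W₂.equivFin ⟨B, hB2⟩)⟩)
  obtain ⟨hP, hroot⟩ := isPiece_join (k := W₁.card) (c := c) hJ hcoreF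
    (fun hk i hi j hj => (hfrom hk i hi).trans hI ht htR (hto hk j hj))
    (fun i => hc0.symm ▸ .of_rel (hud i)) hwit (by split_ifs <;> omega)
  rw [hc0] at hP
  refine ⟨_, _, { hP with card := ?_ }, fun h => hroot ?_⟩
  · obtain ⟨s, hs, hsc⟩ := hP.card
    refine ⟨s, hs, hsc.trans ?_⟩
    change _ ≤ 1 + W.card * M
    rw [← hcard, add_mul]
    have := Nat.le_mul_of_pos_right W₁.card hM
    omega
  · refine Finset.card_eq_zero.2 (Finset.eq_empty_of_forall_notMem fun B hB => ?_)
    obtain ⟨v, huv, -, hv⟩ := (Finset.mem_filter.1 hB).2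
    exact h v huv hv

/-- The induction step for the existence of pieces. If `d` has a successor that sees the same concept
names, the piece continues with a final cluster of such successors, entered at a critical element
if it has one. -/
lemma exists_isPiece_step (hI : I.IsTransitive) (ht : t.IsTransitive) (htR : t ∈ R) {M : ℕ}
    (hM : 1 ≤ M) {d : I.Dom}
    (hpieces : ∀ e, (I.seen t E e).card < (I.seen t E d).card →
      ∃ J lab, IsPiece S t E e M J lab) :
    ∃ J lab, IsPiece S t E d (2 + (I.seen t E d).card * M) J lab ∧
      ∀ q, ¬ J.edge q rootPos := by
  by_cases hd : ∃ e, I.rel t d e ∧ I.seen t E e = I.seen t E d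
  · obtain ⟨u, hdu, hus, hu, huF⟩ : ∃ u, I.rel t d u ∧ I.seen t E u = I.seen t E d ∧
        (∀ v, I.rel t u v → I.seen t E v = I.seen t E u → S.Sees t v u) ∧
        (u ∈ I.conc F ∨ ∀ v, I.rel t u v → I.seen t E v = I.seen t E u → v ∉ I.conc F) := by
      obtain ⟨u, ⟨hdu, hus⟩, hu⟩ := S.recurrent ht E d hd
      by_cases hc : ∃ c, I.rel t u c ∧ I.seen t E c = I.seen t E u ∧ c ∈ I.conc F
      · obtain ⟨c, huc, hcs, hcF⟩ := hc
        refine ⟨c, hI t ht _ _ _ hdu huc, hcs.trans hus, fun v hcv hv => ?_, Or.inl hcF⟩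
        have hvu : S.Sees t v u := hu v (hI t ht _ _ _ huc hcv) (hv.trans (hcs.trans hus))
        exact hvu.trans hI ht htR (.of_rel huc)
      · exact ⟨u, hdu, hus, fun v huv hv => hu v huv (hv.trans hus),
          Or.inr fun v huv hv hvF => hc ⟨v, huv, hv, hvF⟩⟩
    obtain ⟨J, lab, hJ, -⟩ := exists_isPiece_final (S := S) hI ht htR hM (hus.symm ▸ hpieces) hu huF
    obtain ⟨hP, hroot⟩ := isPiece_join (k := 0) (c := fun _ => d) (d := fun _ : Fin 1 => u)
      (J := fun _ => J) (lab := fun _ => lab) (fun _ => hJ)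
      (by by_cases h : d ∈ I.conc F
          · exact Or.inl h
          · exact Or.inr fun _ _ => h)
      (fun h => absurd h (lt_irrefl 0)) (fun _ => .of_rel hdu)
      (fun _ _ B hB => Or.inr (Or.inr ⟨0, hus.symm ▸ hB⟩)) (by simp)
    refine ⟨_, _, { hP with card := ?_ }, hroot rfl⟩
    obtain ⟨s, hs, hsc⟩ := hP.card
    exact ⟨s, hs, hsc.trans (by rw [hus]; omega)⟩
  · push Not at hd
    obtain ⟨J, lab, hJ, hroot⟩ := exists_isPiece_final (S := S) hI ht htR hM hpieces
      (fun v hdv hv => absurd hv (hd v hdv)) (Or.inr fun v hdv hv => absurd hv (hd v hdv))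
    refine ⟨J, lab, { hJ with card := ?_ }, hroot hd⟩
    obtain ⟨s, hs, hsc⟩ := hJ.card
    exact ⟨s, hs, hsc.trans (by omega)⟩

/-- Each element of a saturated interpretation is the label of the root of a piece. -/
theorem exists_isPiece (S : I.Saturation R F) (hI : I.IsTransitive) (ht : t.IsTransitive)
    (htR : t ∈ R) {l : ℕ} (hl : 1 ≤ l) (hE : E.card ≤ l) (d : I.Dom) :
    ∃ J lab, IsPiece S t E d ((l + 1) ^ (l + 1) ^ 2) J lab ∧ ∀ q, ¬ J.edge q rootPos := by
  have key : ∀ w d, (I.seen t E d).card ≤ w →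
      ∃ J lab, IsPiece S t E d ((l + 1) ^ (2 * w + 1)) J lab ∧ ∀ q, ¬ J.edge q rootPos := by
    intro w
    induction w with
    | zero =>
      intro d hd
      obtain ⟨J, lab, hJ, hroot⟩ := exists_isPiece_step (S := S) (E := E) (d := d) hI ht htR le_rfl
        fun e he => absurd he (by omega)
      refine ⟨J, lab, { hJ with card := ?_ }, hroot⟩
      obtain ⟨s, hs, hsc⟩ := hJ.card
      refine ⟨s, hs, hsc.trans ?_⟩
      rw [Nat.le_zero.1 hd]
      simpa using hl
    | succ w ih =>
      intro d hd
      have hM : 1 ≤ (l + 1) ^ (2 * w + 1) := Nat.one_le_pow _ _ (by omega)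
      obtain ⟨J, lab, hJ, hroot⟩ := exists_isPiece_step (S := S) (E := E) (d := d) hI ht htR hM
        fun e he => by
          obtain ⟨J, lab, hJ, -⟩ := ih e (by omega)
          exact ⟨J, lab, hJ⟩
      refine ⟨J, lab, { hJ with card := ?_ }, hroot⟩
      obtain ⟨s, hs, hsc⟩ := hJ.card
      refine ⟨s, hs, hsc.trans ?_⟩
      have hseen : (I.seen t E d).card ≤ l := (I.card_seen_le t E d).trans hE
      have h1 := Nat.mul_le_mul_right ((l + 1) ^ (2 * w + 1)) hseen
      have h2 : (l + 1) ^ (2 * (w + 1) + 1) = (l + 1) ^ (2 * w + 1) * (l * l + 2 * l + 1) := by ring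
      rw [h2]
      nlinarith
  obtain ⟨J, lab, hJ, hroot⟩ := key l d ((I.card_seen_le t E d).trans hE)
  refine ⟨J, lab, { hJ with card := ?_ }, hroot⟩
  obtain ⟨s, hs, hsc⟩ := hJ.card
  exact ⟨s, hs, hsc.trans (Nat.pow_le_pow_right (by omega) (by nlinarith))⟩

end RoleInterp

/-! ### Quasi-unravellings of pieces -/

namespace RoleInterp

open Relation

section Lift

variable {Δ : Type*} {F : ConceptName} {J : RoleInterp Δ} {b : Δ}

lemma exists_qStep (hb : ∀ p, ¬ J.edge p b) {x : QElem Δ} (hx : QDom F J b x) {q : Δ}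
    (h : J.edge x.orig q) : ∃ y, QDom F J b y ∧ y.orig = q ∧ QStep F J b x y := by
  have hqb : q ≠ b := by
    rintro rfl
    exact hb _ h
  have hq : q ∈ J.dom := J.edge_right _ _ h
  by_cases hc : J.InCritical F q
  · refine ⟨.single q, Or.inl hc, rfl, ?_⟩
    cases x with
    | single p => exact .single_single hx hc h
    | copy K p w => exact .copy_single hx hc h
  · cases x with
    | single p =>
      have hK : ∃ K, (K = J.rootCluster F b ∨ ∃ x, J.InCritical F x ∧ K = J.cluster x) ∧ p ∈ K := by
        by_cases hp : J.InCritical F p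
        · exact ⟨_, Or.inr ⟨p, hp, rfl⟩, hp.1, .refl, .refl⟩
        · obtain rfl : p = b := Or.resolve_left hx hp
          exact ⟨_, Or.inl rfl, by simp [rootCluster, hp]⟩
      obtain ⟨K, hK, hpK⟩ := hK
      have hy : QDom F J b (.copy K [] q) :=
        ⟨hK, by simp, by simp [hq, hc, hqb], p, hpK, q, rfl, h⟩
      exact ⟨_, hy, rfl, .single_copy hy hpK⟩
    | copy K p w =>
      obtain ⟨hK, hch, hall, u, hu, v, hv, huv⟩ := id hx
      have hy : QDom F J b (.copy K (p ++ [w]) q) := by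
        refine ⟨hK, ?_, ?_, u, hu, v, ?_, huv⟩
        · refine List.isChain_append.2 ⟨hch, by simp, fun x hx y hy => ?_⟩
          have h1 : x = w := by simpa using hx.symm
          have h2 : y = q := by simpa using hy.symm
          rw [h1, h2]
          exact h
        · intro y hy
          rcases List.mem_append.1 hy with hy | hy
          · exact hall y hy
          · rw [List.mem_singleton.1 hy]
            exact ⟨hq, hc, hqb⟩
        · rw [List.head?_append, hv]
          rfl
      exact ⟨_, hy, rfl, .copy_copy hx hy⟩

/-- Paths lift to the quasi-unravelling, provided that no edge leads to the root. -/
lemma exists_qEdge (hb : ∀ p, ¬ J.edge p b) {x : QElem Δ} (hx : QDom F J b x) {q : Δ}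
    (h : TransGen J.edge x.orig q) : ∃ y, QDom F J b y ∧ y.orig = q ∧ QEdge F J b x y := by
  induction h with
  | single h =>
    obtain ⟨y, hy, hq, hxy⟩ := exists_qStep hb hx h
    exact ⟨y, hy, hq, .single hxy⟩
  | tail _ h ih =>
    obtain ⟨y, hy, rfl, hxy⟩ := ih
    obtain ⟨z, hz, hq, hyz⟩ := exists_qStep hb hy h
    exact ⟨z, hz, hq, hxy.tail hyz⟩

lemma InCritical.of_mem_cluster {x y : Δ} (hx : J.InCritical F x) (hy : y ∈ J.cluster x) :
    J.InCritical F y := by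
  obtain ⟨-, c, ⟨hc, hxc, hcx⟩, hcF⟩ := hx
  exact ⟨hy.1, c, ⟨hc, hy.2.2.trans hxc, hcx.trans hy.2.1⟩, hcF⟩

lemma reach_of_mem_startCluster {K : Set Δ}
    (hK : K = J.rootCluster F b ∨ ∃ x, J.InCritical F x ∧ K = J.cluster x) {x y : Δ} (hx : x ∈ K)
    (hy : y ∈ K) : x = y ∨ (TransGen J.edge x y ∧ J.InCritical F y) := by
  have main : ∀ z, J.InCritical F z → K = J.cluster z →
      x = y ∨ (TransGen J.edge x y ∧ J.InCritical F y) := by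
    rintro z hz rfl
    rcases reflTransGen_iff_eq_or_transGen.1 (hx.2.2.trans hy.2.1) with h | h
    · exact Or.inl h.symm
    · exact Or.inr ⟨h, hz.of_mem_cluster hy⟩
  rcases hK with hK | ⟨z, hz, hK⟩
  · by_cases hb : J.InCritical F b
    · exact main b hb (by simpa [rootCluster, hb] using hK)
    · rw [hK] at hx hy
      simp only [rootCluster, hb, if_false, Set.mem_singleton_iff] at hx hy
      exact Or.inl (hx.trans hy.symm)
  · exact main z hz hK

lemma QDom.orig_mem {x : QElem Δ} (hb : b ∈ J.dom) (hx : QDom F J b x) : x.orig ∈ J.dom := by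
  cases x with
  | single x => exact hx.elim (fun h => h.1) fun h => h ▸ hb
  | copy K p w => exact (hx.2.2.1 w (by simp)).1

lemma QStep.left {x y : QElem Δ} (h : QStep F J b x y) : x.orig ∈ J.dom := by
  cases h with
  | single_single _ _ h => exact J.edge_left _ _ h
  | single_copy h hx =>
    obtain ⟨hK, -, -, u, hu, v, -, huv⟩ := h
    rcases reach_of_mem_startCluster hK hx hu with h | h
    · exact h ▸ J.edge_left _ _ huv
    · obtain ⟨z, hz, -⟩ := TransGen.head'_iff.1 h.1
      exact J.edge_left _ _ hz
  | copy_copy h _ => exact (h.2.2.1 _ (by simp [QElem.orig])).1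
  | copy_single h _ _ => exact (h.2.2.1 _ (by simp [QElem.orig])).1

lemma QStep.right {x y : QElem Δ} (h : QStep F J b x y) : QDom F J b y := by
  cases h with
  | single_single _ h _ => exact Or.inl h
  | single_copy h _ => exact h
  | copy_copy _ h => exact h
  | copy_single _ h _ => exact Or.inl h

lemma QEdge.left {x y : QElem Δ} (h : QEdge F J b x y) : x.orig ∈ J.dom := by
  obtain ⟨z, hz, -⟩ := TransGen.head'_iff.1 h
  exact hz.left

lemma QEdge.right {x y : QElem Δ} (h : QEdge F J b x y) : QDom F J b y := by
  obtain ⟨z, -, hz⟩ := TransGen.tail'_iff.1 h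
  exact hz.right

end Lift

section Hom

variable {I : Interp.{u}} {R : Finset RoleName} {F : ConceptName} {S : I.Saturation R F}
  {t : RoleName} {Δ : Type*} {J : RoleInterp Δ} {lab : Δ → I.Dom} {b : Δ} {d₀ : I.Dom}

lemma sees_of_transGen (hI : I.IsTransitive) (ht : t.IsTransitive) (htR : t ∈ R)
    (hJ : ∀ p q, J.edge p q → S.Sees t (lab p) (lab q)) {p q : Δ} (h : TransGen J.edge p q) :
    S.Sees t (lab p) (lab q) := by
  induction h with
  | single h => exact hJ _ _ h
  | tail _ h ih => exact ih.trans hI ht htR (hJ _ _ h)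

/-- Critical clusters are nominals: what sees an element of a critical cluster up to `sim`, has as
successors all elements that are indistinguishable from it. -/
lemma rel_of_inCritical (hI : I.IsTransitive) (ht : t.IsTransitive) (htR : t ∈ R)
    (hJ : ∀ p q, J.edge p q → S.Sees t (lab p) (lab q))
    (hF : ∀ p ∈ J.conc F, lab p ∈ I.conc F) {y : Δ} (hy : J.InCritical F y) {u v : I.Dom}
    (hv : S.sim v (lab y)) (hu : S.Sees t u (lab y)) : I.rel t u v := by
  obtain ⟨-, c, ⟨-, hyc, hcy⟩, hcF⟩ := hy
  have hc := hF c hcF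
  have nominal : ∀ {z}, S.Sees t z (lab c) → I.rel t z (lab c) := by
    rintro z ⟨e, hze, he⟩
    rwa [S.eq_of_mem (S.equiv.symm he) hc]
  rcases reflTransGen_iff_eq_or_transGen.1 hyc with rfl | hyc
  · exact S.eq_of_mem (S.equiv.symm hv) hc ▸ nominal hu
  rcases reflTransGen_iff_eq_or_transGen.1 hcy with rfl | hcy
  · exact S.eq_of_mem (S.equiv.symm hv) hc ▸ nominal hu
  obtain ⟨e, hue, he⟩ := hu
  have hec : I.rel t e (lab c) := nominal
    ((sees_of_transGen hI ht htR hJ hyc).congr htR (S.equiv.symm he) (S.equiv.refl _))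
  obtain ⟨f, hcf, hf⟩ := sees_of_transGen hI ht htR hJ hcy
  obtain ⟨c', hc', hcc'⟩ := S.back htR (S.equiv.trans hf (S.equiv.symm hv)) hcf
  rw [← S.eq_of_mem hcc' hc] at hc'
  exact hI t ht _ _ _ hue (hI t ht _ _ _ hec hc')

open Classical in
/-- The image of an original element of the quasi-unravelling: its label, except for the root, whose
image `d₀` is prescribed. -/
noncomputable def singleImage (lab : Δ → I.Dom) (b : Δ) (d₀ : I.Dom) (x : Δ) : I.Dom :=
  if x = b then d₀ else lab x

open Classical in
/-- The image of the last element of a path, which is given in reverse order. -/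
noncomputable def pathImage (S : I.Saturation R F) (t : RoleName) (lab : Δ → I.Dom) (b : Δ)
    (d₀ : I.Dom) (K : Set Δ) : List Δ → I.Dom
  | [] => d₀
  | [w] => if h : ∃ e, (∀ x ∈ K, I.rel t (singleImage lab b d₀ x) e) ∧ S.sim e (lab w)
      then h.choose else lab w
  | w :: v :: l => if h : ∃ e, I.rel t (pathImage S t lab b d₀ K (v :: l)) e ∧ S.sim e (lab w)
      then h.choose else lab w

/-- A homomorphism from the quasi-unravelling to `I`. -/
noncomputable def image (S : I.Saturation R F) (t : RoleName) (lab : Δ → I.Dom) (b : Δ)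
    (d₀ : I.Dom) : QElem Δ → I.Dom
  | .single x => singleImage lab b d₀ x
  | .copy K p w => pathImage S t lab b d₀ K (w :: p.reverse)

lemma sim_singleImage (hd : S.sim d₀ (lab b)) (x : Δ) :
    S.sim (singleImage lab b d₀ x) (lab x) := by
  unfold singleImage
  split_ifs with h
  · exact h ▸ hd
  · exact S.equiv.refl _

lemma sim_pathImage (K : Set Δ) (w : Δ) (l : List Δ) :
    S.sim (pathImage S t lab b d₀ K (w :: l)) (lab w) := by
  cases l with
  | nil =>
    unfold pathImage
    split_ifs with h
    · exact h.choose_spec.2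
    · exact S.equiv.refl _
  | cons v l =>
    unfold pathImage
    split_ifs with h
    · exact h.choose_spec.2
    · exact S.equiv.refl _

lemma sim_image (hd : S.sim d₀ (lab b)) (x : QElem Δ) :
    S.sim (image S t lab b d₀ x) (lab x.orig) := by
  cases x with
  | single x => exact sim_singleImage hd x
  | copy K p w => exact sim_pathImage K w _

lemma rel_pathImage_cons {K : Set Δ} {w v : Δ} {l : List Δ} (htR : t ∈ R)
    (h : S.Sees t (lab v) (lab w)) : I.rel t (pathImage S t lab b d₀ K (v :: l))
      (pathImage S t lab b d₀ K (w :: v :: l)) := by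
  have hex : ∃ e, I.rel t (pathImage S t lab b d₀ K (v :: l)) e ∧ S.sim e (lab w) :=
    h.congr htR (S.equiv.symm (sim_pathImage K v l)) (S.equiv.refl _)
  rw [show pathImage S t lab b d₀ K (w :: v :: l) = hex.choose from dif_pos hex]
  exact hex.choose_spec.1

lemma rel_single_pathImage (hI : I.IsTransitive) (ht : t.IsTransitive) (htR : t ∈ R)
    (hJ : ∀ p q, J.edge p q → S.Sees t (lab p) (lab q))
    (hF : ∀ p ∈ J.conc F, lab p ∈ I.conc F) (hd : S.sim d₀ (lab b)) {K : Set Δ}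
    (hK : K = J.rootCluster F b ∨ ∃ x, J.InCritical F x ∧ K = J.cluster x) {x : Δ} (hx : x ∈ K)
    (l : List Δ) (w : Δ) (hch : (w :: l).IsChain fun p q => J.edge q p)
    (hlast : ∃ u ∈ K, ∃ v ∈ (w :: l).getLast?, J.edge u v) :
    I.rel t (singleImage lab b d₀ x) (pathImage S t lab b d₀ K (w :: l)) := by
  induction l generalizing w with
  | nil =>
    obtain ⟨u, hu, v, hv, huv⟩ := hlast
    obtain rfl : w = v := by simpa using hv
    have hex : ∃ e, (∀ x ∈ K, I.rel t (singleImage lab b d₀ x) e) ∧ S.sim e (lab w) := by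
      obtain ⟨e, hue, he⟩ :=
        (hJ u w huv).congr htR (S.equiv.symm (sim_singleImage hd u)) (S.equiv.refl _)
      refine ⟨e, fun y hy => ?_, he⟩
      rcases reach_of_mem_startCluster hK hy hu with rfl | ⟨hyu, hcu⟩
      · exact hue
      · exact hI t ht _ _ _ (rel_of_inCritical hI ht htR hJ hF hcu (sim_singleImage hd u)
          ((sees_of_transGen hI ht htR hJ hyu).congr htR
            (S.equiv.symm (sim_singleImage hd y)) (S.equiv.refl _))) hue
    rw [show pathImage S t lab b d₀ K [w] = hex.choose from dif_pos hex]
    exact hex.choose_spec.1 x hx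
  | cons v l ih =>
    obtain ⟨hvw, hch⟩ := List.isChain_cons_cons.1 hch
    rw [List.getLast?_cons_cons] at hlast
    exact hI t ht _ _ _ (ih v hch hlast) (rel_pathImage_cons htR (hJ _ _ hvw))

lemma rel_image (hI : I.IsTransitive) (ht : t.IsTransitive) (htR : t ∈ R)
    (hJ : ∀ p q, J.edge p q → S.Sees t (lab p) (lab q))
    (hF : ∀ p ∈ J.conc F, lab p ∈ I.conc F) (hd : S.sim d₀ (lab b)) {x y : QElem Δ}
    (h : QEdge F J b x y) : I.rel t (image S t lab b d₀ x) (image S t lab b d₀ y) := by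
  have step : ∀ {x y}, QStep F J b x y →
      I.rel t (image S t lab b d₀ x) (image S t lab b d₀ y) := by
    intro x y h
    cases h with
    | single_single hx hy hxy =>
      exact rel_of_inCritical hI ht htR hJ hF hy (sim_singleImage hd _)
        ((hJ _ _ hxy).congr htR (S.equiv.symm (sim_singleImage hd _)) (S.equiv.refl _))
    | @single_copy x K p w hq hx =>
      obtain ⟨hK, hch, -, hhd⟩ := hq
      refine rel_single_pathImage hI ht htR hJ hF hd hK hx _ w ?_ ?_
      · have := List.isChain_reverse.2 hch
        simpa [flip] using this
      · have : (w :: p.reverse).getLast? = (p ++ [w]).head? := by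
          rw [← List.getLast?_reverse]
          simp
        rwa [this]
    | @copy_copy K p w y hq hq' =>
      have hwy : J.edge w y := (List.isChain_append.1 hq'.2.1).2.2 w (by simp) y (by simp)
      simp only [image, List.reverse_append, List.reverse_cons, List.reverse_nil, List.nil_append,
        List.singleton_append]
      exact rel_pathImage_cons htR (hJ _ _ hwy)
    | copy_single hq hy hxy =>
      exact rel_of_inCritical hI ht htR hJ hF hy (sim_singleImage hd _)
        ((hJ _ _ hxy).congr htR (S.equiv.symm (sim_pathImage _ _ _)) (S.equiv.refl _))
  induction h with
  | single h => exact step h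
  | tail _ h ih => exact hI t ht _ _ _ ih (step h)

end Hom

end RoleInterp

/-! ### The tree of pieces -/

open RoleInterp Relation

/-- The data of an inclusion `A ⊑ ∃ r. B`. -/
abbrev ExData := ConceptName × RoleName × ConceptName

namespace TBox

lemma exData_injective :
    Function.Injective fun e : ExData => ConceptInclusion.ex e.1 e.2.1 e.2.2 := by
  rintro ⟨A, r, B⟩ ⟨A', r', B'⟩ h
  cases h
  rfl

/-- The inclusions `A ⊑ ∃ r. B` of a TBox. -/
noncomputable def exs (T : TBox) : Finset ExData :=
  T.preimage (fun e => ConceptInclusion.ex e.1 e.2.1 e.2.2) exData_injective.injOn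

lemma mem_exs {T : TBox} {e : ExData} : e ∈ T.exs ↔ ConceptInclusion.ex e.1 e.2.1 e.2.2 ∈ T := by
  simp [exs]

/-- The concept names `B` of the inclusions `A ⊑ ∃ r. B`, for fixed `r`. -/
noncomputable def targets (T : TBox) (r : RoleName) : Finset ConceptName :=
  (T.exs.filter fun e => e.2.1 = r).image fun e => e.2.2

lemma mem_targets {T : TBox} {e : ExData} (he : e ∈ T.exs) : e.2.2 ∈ T.targets e.2.1 :=
  Finset.mem_image.2 ⟨e, Finset.mem_filter.2 ⟨he, rfl⟩, rfl⟩

lemma role_mem_roles {T : TBox} {e : ExData} (he : e ∈ T.exs) : e.2.1 ∈ T.roles :=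
  Finset.mem_biUnion.2 ⟨_, mem_exs.1 he, Finset.mem_singleton_self _⟩

lemma targets_subset (T : TBox) (r : RoleName) : T.targets r ⊆ T.concepts := by
  intro B hB
  obtain ⟨e, he, rfl⟩ := Finset.mem_image.1 hB
  exact Finset.mem_biUnion.2 ⟨_, mem_exs.1 (Finset.mem_filter.1 he).1,
    Finset.mem_insert_of_mem (Finset.mem_singleton_self _)⟩

lemma five_mul_card_exs_le (T : TBox) : 5 * T.exs.card ≤ T.size := by
  classical
  have h : (T.exs.image fun e => ConceptInclusion.ex e.1 e.2.1 e.2.2) ⊆ T := by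
    intro c hc
    obtain ⟨e, he, rfl⟩ := Finset.mem_image.1 hc
    exact mem_exs.1 he
  have h1 := Finset.sum_le_sum_of_subset (f := ConceptInclusion.size) h
  rw [Finset.sum_image exData_injective.injOn] at h1
  have h2 : ∀ e : ExData, (ConceptInclusion.ex e.1 e.2.1 e.2.2).size = 5 := fun _ => rfl
  simp only [h2, Finset.sum_const, smul_eq_mul] at h1
  unfold TBox.size
  omega

end TBox

/-- The pieces from which the tree of pieces is built: pieces over the transitive role names in `R`,
and singletons for the other role names. The index `r` is the role name of the edge that leads to
the root of the piece. -/
structure PieceSpec {I : Interp.{u}} {R : Finset RoleName} {F : ConceptName} (S : I.Saturation R F)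
    (r : RoleName) (E : Finset ConceptName) (d : I.Dom) (N : ℕ) (J : RoleInterp Pos)
    (lab : Pos → I.Dom) : Prop where
  coreTree : CoreTree F J rootPos
  lab_root : lab rootPos = d
  mem_conc : ∀ A p, p ∈ J.conc A ↔ p ∈ J.dom ∧ lab p ∈ I.conc A
  card : ∃ s : Finset Pos, J.dom ⊆ s ∧ s.card ≤ N
  into : ∀ p, {q | J.edge q p}.encard ≤ 2
  not_edge_root : ∀ p, ¬ J.edge p rootPos
  transitive_of_edge : ∀ p q, J.edge p q → r.IsTransitive
  sees : ∀ p q, J.edge p q → S.Sees r (lab p) (lab q)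
  out : ∀ p, {q | J.edge p q}.encard ≤ (E.card + 1 : ℕ)
  witness : r.IsTransitive → ∀ p ∈ J.dom, ∀ B ∈ I.seen r E (lab p),
    ∃ q, TransGen J.edge p q ∧ lab q ∈ I.conc B
  dom_eq : ¬ r.IsTransitive → J.dom = {rootPos}

lemma exists_pieceSpec {I : Interp.{u}} {R : Finset RoleName} {F : ConceptName}
    (S : I.Saturation R F) (hI : I.IsTransitive) {r : RoleName} (hr : r ∈ R)
    {E : Finset ConceptName} {l : ℕ} (hl : 1 ≤ l) (hE : E.card ≤ l) (d : I.Dom) :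
    ∃ J lab, PieceSpec S r E d ((l + 1) ^ (l + 1) ^ 2) J lab := by
  by_cases ht : r.IsTransitive
  · obtain ⟨J, lab, hJ, hroot⟩ := exists_isPiece S hI ht hr hl hE d
    exact ⟨J, lab, hJ.coreTree, hJ.lab_root, hJ.mem_conc, hJ.card, hJ.into, hroot,
      fun _ _ _ => ht, hJ.sees, hJ.out, fun _ => hJ.witness, fun h => absurd ht h⟩
  · let J : RoleInterp Pos := join (n := 0) (core I.conc 0 fun _ => d) fun i => i.elim0
    have hno : ∀ p q, ¬ J.edge p q := by
      intro p q h
      rcases (join_edge (show rootPos ∈ (core I.conc 0 fun _ => d).dom from ⟨rfl, le_rfl⟩)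
          fun i => i.elim0).1 h with h | ⟨i, -⟩ | ⟨-, i, -⟩
      · exact absurd h.1 (lt_irrefl 0)
      · exact i.elim0
      · exact i.elim0
    have hdom : J.dom = {rootPos} := by
      ext p
      constructor
      · rintro (⟨h1, h2⟩ | ⟨i, -⟩)
        · exact Prod.ext h1 (Nat.le_zero.1 h2)
        · exact i.elim0
      · rintro rfl
        exact Or.inl ⟨rfl, le_rfl⟩
    refine ⟨J, fun _ => d, .attach (core_isCore ?_) (fun i => i.elim0) (fun i => i.elim0)
      fun i => i.elim0, rfl, fun A p => ?_, ⟨{rootPos}, by simp [hdom], ?_⟩, ?_, fun p => hno p _,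
      fun p q h => absurd h (hno p q), fun p q h => absurd h (hno p q), ?_,
      fun h => absurd h ht, fun _ => hdom⟩
    · by_cases h : d ∈ I.conc F
      · exact Or.inl h
      · exact Or.inr fun _ _ => h
    · constructor
      · rintro (⟨h1, h2⟩ | ⟨i, -⟩)
        · exact ⟨Or.inl h1, h2⟩
        · exact i.elim0
      · rintro ⟨h1 | ⟨i, -⟩, h2⟩
        · exact Or.inl ⟨h1, h2⟩
        · exact i.elim0
    · simpa using Nat.one_le_pow _ _ (by omega)
    · intro p
      simp [hno]
    · intro p
      simp [hno]

/-- Everything that determines the tree of pieces: a saturated model of a TBox, the element for the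
root piece, the choice of a piece for each role name and element, and the choice of witnesses for
existential restrictions. -/
structure Blueprint (T : TBox) (F : ConceptName) (N : ℕ) where
  I : Interp.{u}
  S : I.Saturation T.roles F
  trans : I.IsTransitive
  sat : ∀ c ∈ T, I.SatInclusion c
  start : I.Dom
  J : RoleName → I.Dom → RoleInterp Pos
  lab : RoleName → I.Dom → Pos → I.Dom
  spec : ∀ r ∈ T.roles, ∀ d, PieceSpec S r (T.targets r) d N (J r d) (lab r d)
  next : ExData → I.Dom → I.Dom
  next_spec : ∀ e ∈ T.exs, ∀ d ∈ I.conc e.1, I.rel e.2.1 d (next e d) ∧ next e d ∈ I.conc e.2.2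
  one_le : 1 ≤ N

/-- Elements of the tree of pieces: the root is `[]`, and `(e, p) :: l` is the position `p` in the
child piece of the element `l` for the existential restriction `e`. -/
abbrev Code := List (ExData × Pos)

namespace Blueprint

variable {T : TBox} {F : ConceptName} {N : ℕ} (X : Blueprint.{u} T F N)

/-- The element of the saturated model that is represented by an element of the tree of pieces. -/
def label : Code → X.I.Dom
  | [] => X.start
  | (e, p) :: l => X.lab e.2.1 (X.next e (label l)) p

/-- The child piece of `l` for the existential restriction `e`. -/
def pieceAt (e : ExData) (l : Code) : RoleInterp Pos := X.J e.2.1 (X.next e (X.label l))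

/-- The root of the piece of an element. -/
def codeRoot : Code → Code
  | [] => []
  | (e, _) :: l => (e, rootPos) :: l

/-- The transitive role name of the piece of an element, if the piece has one. -/
def codeRole : Code → Option RoleName
  | [] => none
  | (e, _) :: _ => if e.2.1.IsTransitive then some e.2.1 else none

/-- The codes that occur in the tree of pieces. An element has a child for each existential
restriction that applies to it, except for those over the role name of its own piece. -/
def Valid : Code → Prop
  | [] => True
  | (e, p) :: l => Valid l ∧ e ∈ T.exs ∧ X.label l ∈ X.I.conc e.1 ∧ codeRole l ≠ some e.2.1 ∧
      p ∈ (X.pieceAt e l).dom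

/-- The edges of the tree of pieces. -/
inductive Rel (r : RoleName) : Code → Code → Prop
  | inner {e : ExData} {p q : Pos} {l : Code} : e.2.1 = r → (X.pieceAt e l).edge p q →
      Rel r ((e, p) :: l) ((e, q) :: l)
  | cross {e : ExData} {l : Code} : e.2.1 = r → Rel r l ((e, rootPos) :: l)

lemma valid_spec {e : ExData} {p : Pos} {l : Code} (h : X.Valid ((e, p) :: l)) :
    PieceSpec X.S e.2.1 (T.targets e.2.1) (X.next e (X.label l)) N (X.pieceAt e l)
      (X.lab e.2.1 (X.next e (X.label l))) :=
  X.spec _ (TBox.role_mem_roles h.2.1) _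

lemma valid_iff {e : ExData} {p q : Pos} {l : Code} (h : X.Valid ((e, p) :: l)) :
    X.Valid ((e, q) :: l) ↔ q ∈ (X.pieceAt e l).dom :=
  ⟨fun h' => h'.2.2.2.2, fun h' => ⟨h.1, h.2.1, h.2.2.1, h.2.2.2.1, h'⟩⟩

lemma valid_codeRoot {x : Code} (h : X.Valid x) : X.Valid (codeRoot x) := by
  match x, h with
  | [], h => exact h
  | (e, p) :: l, h => exact (X.valid_iff h).2 (X.valid_spec h).coreTree.mem_dom

lemma codeRoot_codeRoot (x : Code) : codeRoot (codeRoot x) = codeRoot x := by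
  cases x <;> rfl

lemma length_codeRoot (x : Code) : (codeRoot x).length = x.length := by
  cases x <;> rfl

lemma codeRole_codeRoot (x : Code) : codeRole (codeRoot x) = codeRole x := by
  cases x <;> rfl

lemma exists_eq_of_codeRoot_eq {x : Code} {e : ExData} {p : Pos} {l : Code}
    (h : codeRoot x = (e, p) :: l) : ∃ q, x = (e, q) :: l := by
  match x, h with
  | (e', q) :: l', h =>
    obtain ⟨h1, rfl⟩ := List.cons.inj h
    exact ⟨q, by rw [(Prod.mk.inj h1).1]⟩

lemma codeRole_of_transitive {e : ExData} (h : e.2.1.IsTransitive) (p : Pos) (l : Code) :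
    codeRole ((e, p) :: l) = some e.2.1 := if_pos h

lemma codeRole_eq_some {x : Code} {t : RoleName} (h : codeRole x = some t) :
    t.IsTransitive ∧ ∃ e p l, x = (e, p) :: l ∧ e.2.1 = t := by
  match x, h with
  | (e, p) :: l, h =>
    by_cases he : e.2.1.IsTransitive
    · rw [codeRole_of_transitive he] at h
      obtain rfl := Option.some.inj h
      exact ⟨he, e, p, l, rfl, rfl⟩
    · simp [codeRole, he] at h

/-- The interpretation given by the tree of pieces; the individual `a` denotes its root. -/
abbrev tree (a : Individual) : Interp.{0} where
  Dom := {x : Code // X.Valid x}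
  ind c := if c = a then some ⟨[], trivial⟩ else none
  ind_inj c c' d h h' := by
    split_ifs at h h' with hc hc'
    exact hc.trans hc'.symm
  conc A := {x | X.label x.1 ∈ X.I.conc A}
  rel r x y := X.Rel r x.1 y.1
  finite_occurring := X.I.finite_occurring.subset fun _ ⟨x, hx⟩ => ⟨X.label x.1, hx⟩

/-- The root of the tree of pieces. -/
def treeRoot (a : Individual) : (X.tree a).Dom := ⟨[], trivial⟩

variable {X}

lemma Rel.eq_codeRoot {r : RoleName} {x y : Code} (h : X.Rel r x y) (hne : codeRoot x ≠ codeRoot y) :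
    ∃ e : ExData, e.2.1 = r ∧ y = (e, rootPos) :: x := by
  cases h with
  | inner _ _ => exact absurd rfl hne
  | @cross e _ h => exact ⟨e, h, rfl⟩

lemma cons_ne_codeRoot (e : ExData) (p : Pos) (x : Code) : codeRoot x ≠ (e, p) :: x := by
  intro h
  have := congrArg List.length h
  rw [length_codeRoot, List.length_cons] at this
  omega

lemma Rel.role_eq {r : RoleName} {x : Code} {e : ExData} {p : Pos} {l : Code}
    (h : X.Rel r x ((e, p) :: l)) : e.2.1 = r := by
  cases h with
  | inner h _ => exact h
  | cross h => exact h

lemma Rel.inner_of_codeRoot_eq {r : RoleName} {x y : Code} (h : X.Rel r x y)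
    (heq : codeRoot x = codeRoot y) : ∃ (e : ExData) (p q : Pos) (l : Code), e.2.1 = r ∧
      x = (e, p) :: l ∧ y = (e, q) :: l ∧ (X.pieceAt e l).edge p q := by
  cases h with
  | @inner e p q l h1 h2 => exact ⟨e, p, q, l, h1, rfl, rfl, h2⟩
  | @cross e _ h => exact absurd heq (cons_ne_codeRoot e rootPos x)

variable (X)

/-- The decomposition of the tree of pieces into its pieces. -/
def decomposition (a : Individual) : PieceDecomposition (X.tree a) (X.treeRoot a) where
  root x := ⟨codeRoot x.1, X.valid_codeRoot x.2⟩
  role x := codeRole x.1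
  root_root x := Subtype.ext (codeRoot_codeRoot _)
  root_eq_iff x := by
    obtain ⟨x, hx⟩ := x
    cases x with
    | nil => exact ⟨fun _ => rfl, fun _ => rfl⟩
    | cons _ _ => exact ⟨fun h => absurd (congrArg Subtype.val h) (List.cons_ne_nil _ _),
        fun h => absurd (congrArg Subtype.val h) (List.cons_ne_nil _ _)⟩
  role_root := rfl
  eq_of_none := by
    rintro ⟨b, hb⟩ hroot hrole ⟨x, hx⟩ hxb
    refine Subtype.ext ?_
    have h1 : codeRoot x = b := congrArg Subtype.val hxb
    match x, hx with
    | [], hx => exact h1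
    | (e, p) :: l, hx =>
      subst h1
      have he : ¬ e.2.1.IsTransitive := fun he => by
        have := hrole.symm.trans (codeRole_of_transitive he rootPos l)
        cases this
      have hp := hx.2.2.2.2
      rw [(X.valid_spec hx).dom_eq he] at hp
      obtain rfl := Set.mem_singleton_iff.1 hp
      rfl
  isTransitive_of_some b _ t h := (codeRole_eq_some h).1
  role_of_rel r x y h heq := by
    obtain ⟨e, p, q, l, rfl, hx, -, he⟩ := Rel.inner_of_codeRoot_eq h (congrArg Subtype.val heq)
    have hv : X.Valid ((e, p) :: l) := hx ▸ x.2
    change codeRole (codeRoot x.1) = _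
    rw [codeRole_codeRoot, hx]
    exact codeRole_of_transitive ((X.valid_spec hv).transitive_of_edge _ _ he) p l
  root_of_cross r x y h hne := by
    obtain ⟨e, -, hy⟩ := Rel.eq_codeRoot h fun heq => hne (Subtype.ext heq)
    obtain ⟨y, hv⟩ := y
    obtain rfl : y = _ := hy
    exact ⟨rfl, fun h => absurd (congrArg Subtype.val h) (List.cons_ne_nil _ _)⟩
  existsUnique_parent b hb hne := by
    obtain ⟨b, hv⟩ := b
    have hb' : codeRoot b = b := congrArg Subtype.val hb
    match b, hv, hb' with
    | [], hv, _ => exact absurd rfl hne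
    | (e, p) :: l, hv, hb' =>
      obtain rfl : rootPos = p := (Prod.mk.inj (List.cons.inj hb').1).2
      refine ⟨(e.2.1, ⟨l, hv.1⟩), ⟨.cross rfl, fun h => ?_⟩, ?_⟩
      · exact cons_ne_codeRoot e rootPos l (congrArg Subtype.val h)
      · rintro ⟨r, x⟩ ⟨h, hx⟩
        obtain ⟨e', rfl, he'⟩ := Rel.eq_codeRoot h fun heq => hx (Subtype.ext heq)
        obtain ⟨h1, h2⟩ := List.cons.inj he'
        obtain rfl := (Prod.mk.inj h1).1
        exact Prod.ext rfl (Subtype.ext h2.symm)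
  reach b hb := by
    obtain ⟨b, hv⟩ := b
    have hb' : codeRoot b = b := congrArg Subtype.val hb
    clear hb
    induction hn : b.length generalizing b with
    | zero =>
      obtain rfl := List.length_eq_zero_iff.1 hn
      exact .refl
    | succ n ih =>
      match b, hv, hb', hn with
      | (e, p) :: l, hv, hb', hn =>
        obtain rfl : rootPos = p := (Prod.mk.inj (List.cons.inj hb').1).2
        refine (ih (codeRoot l) (X.valid_codeRoot hv.1) (codeRoot_codeRoot l) ?_).tail ?_
        · rw [length_codeRoot]
          simpa using hn
        · refine ⟨fun h => ?_, e.2.1, ⟨l, hv.1⟩, ?_, .cross rfl⟩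
          · have h1 : codeRoot (codeRoot l) = (e, rootPos) :: l := congrArg Subtype.val h
            rw [codeRoot_codeRoot] at h1
            exact cons_ne_codeRoot e rootPos l h1
          · exact Subtype.ext (codeRoot_codeRoot l).symm
  separated t ht x y h hne := by
    obtain ⟨e, rfl, hy⟩ := Rel.eq_codeRoot h fun heq => hne (Subtype.ext heq)
    have hv : X.Valid ((e, rootPos) :: x.1) := hy ▸ y.2
    have hrole : codeRole x.1 ≠ some e.2.1 := hv.2.2.2.1
    constructor
    · intro x' y' hx' hy' h'
      have hx'' : codeRoot x'.1 = codeRoot x.1 := congrArg Subtype.val hx'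
      have hy'' : codeRoot y'.1 = codeRoot x.1 := congrArg Subtype.val hy'
      obtain ⟨e', p, q, l, he', h1, -, -⟩ := Rel.inner_of_codeRoot_eq h' (hx''.trans hy''.symm)
      apply hrole
      rw [← codeRole_codeRoot, ← hx'', codeRole_codeRoot, h1, ← he']
      exact codeRole_of_transitive (he'.symm ▸ ht) p l
    · rintro ⟨z, _⟩ hz
      obtain ⟨x, hx⟩ := x
      match x, hx with
      | [], _ =>
        have hz' : X.Rel e.2.1 z [] := hz
        cases hz'
      | (e', p) :: l, hx =>
        refine hrole ?_
        have hz' : X.Rel e.2.1 z ((e', rootPos) :: l) := hz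
        have he' : e'.2.1 = e.2.1 := hz'.role_eq
        rw [← he']
        exact codeRole_of_transitive (he'.symm ▸ ht) p l

variable {X} {a : Individual}

lemma piece_edge_iff {b x y : (X.tree a).Dom} : ((X.decomposition a).piece b).edge x y ↔
    codeRoot x.1 = b.1 ∧ codeRoot y.1 = b.1 ∧ ∃ (e : ExData) (p q : Pos) (l : Code),
      x.1 = (e, p) :: l ∧ y.1 = (e, q) :: l ∧ (X.pieceAt e l).edge p q := by
  constructor
  · rintro ⟨hx, hy, t, ht, h⟩
    have hx' : codeRoot x.1 = b.1 := congrArg Subtype.val hx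
    have hy' : codeRoot y.1 = b.1 := congrArg Subtype.val hy
    obtain ⟨e, p, q, l, -, h1, h2, h3⟩ := Rel.inner_of_codeRoot_eq h (hx'.trans hy'.symm)
    exact ⟨hx', hy', e, p, q, l, h1, h2, h3⟩
  · rintro ⟨hx, hy, e, p, q, l, h1, h2, h3⟩
    refine ⟨Subtype.ext hx, Subtype.ext hy, e.2.1, ?_, ?_⟩
    · have hv : X.Valid ((e, p) :: l) := h1 ▸ x.2
      change codeRole b.1 = _
      rw [← hx, codeRole_codeRoot, h1]
      exact codeRole_of_transitive ((X.valid_spec hv).transitive_of_edge _ _ h3) p l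
    · change X.Rel _ _ _
      rw [h1, h2]
      exact .inner rfl h3

open Classical in
/-- The position `p` of the child piece of `l` for `e`, as an element of the tree of pieces; a junk
value outside of the piece. -/
noncomputable def place (X : Blueprint.{u} T F N) (a : Individual) (e : ExData) (l : Code)
    (p : Pos) : (X.tree a).Dom :=
  if h : X.Valid ((e, p) :: l) then ⟨(e, p) :: l, h⟩ else X.treeRoot a

lemma place_val {e : ExData} {l : Code} {p : Pos} (h : X.Valid ((e, p) :: l)) :
    (X.place a e l p).1 = (e, p) :: l :=
  congrArg Subtype.val (dif_pos h)

lemma piece_eq_map {e : ExData} {l : Code} (hv : X.Valid ((e, rootPos) :: l)) :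
    (X.decomposition a).piece ⟨(e, rootPos) :: l, hv⟩ =
      (X.pieceAt e l).map (X.place a e l) := by
  have hval : ∀ p ∈ (X.pieceAt e l).dom, (X.place a e l p).1 = (e, p) :: l := fun p hp =>
    place_val ((X.valid_iff hv).2 hp)
  have hroot : ∀ x : (X.tree a).Dom, codeRoot x.1 = (e, rootPos) :: l →
      ∃ p ∈ (X.pieceAt e l).dom, x = X.place a e l p := by
    intro x hx
    obtain ⟨p, hp⟩ := exists_eq_of_codeRoot_eq hx
    have hpd := (X.valid_iff hv).1 (hp ▸ x.2)
    exact ⟨p, hpd, Subtype.ext (hp.trans (hval p hpd).symm)⟩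
  have hroot' : ∀ p ∈ (X.pieceAt e l).dom,
      (X.decomposition a).root (X.place a e l p) = ⟨(e, rootPos) :: l, hv⟩ := fun p hp =>
    Subtype.ext (show codeRoot _ = _ by rw [hval p hp]; rfl)
  refine eq_of_iff (fun x => ?_) (fun A x => ?_) (fun x y => ?_)
  · constructor
    · intro hx
      obtain ⟨p, hp, rfl⟩ := hroot x (congrArg Subtype.val hx)
      exact ⟨p, hp, rfl⟩
    · rintro ⟨p, hp, rfl⟩
      exact hroot' p hp
  · have hc : ∀ p ∈ (X.pieceAt e l).dom,
        (X.place a e l p ∈ (X.tree a).conc A ↔ p ∈ (X.pieceAt e l).conc A) := by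
      intro p hp
      change X.label (X.place a e l p).1 ∈ X.I.conc A ↔ _
      rw [hval p hp]
      exact ((((X.valid_spec hv).mem_conc A p).trans (and_iff_right hp))).symm
    constructor
    · rintro ⟨hx, hA⟩
      obtain ⟨p, hp, rfl⟩ := hroot x (congrArg Subtype.val hx)
      exact ⟨p, (hc p hp).1 hA, rfl⟩
    · rintro ⟨p, hpA, rfl⟩
      have hp := (X.pieceAt e l).conc_subset A hpA
      exact ⟨hroot' p hp, (hc p hp).2 hpA⟩
  · rw [piece_edge_iff]
    constructor
    · rintro ⟨hx, hy, e', p, q, l', h1, h2, h3⟩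
      have h4 : (e', rootPos) :: l' = (e, rootPos) :: l := by
        rw [h1] at hx
        exact hx
      obtain ⟨h5, rfl⟩ := List.cons.inj h4
      obtain rfl := (Prod.mk.inj h5).1
      exact ⟨p, q, h3, Subtype.ext ((hval p ((X.pieceAt _ _).edge_left _ _ h3)).trans h1.symm),
        Subtype.ext ((hval q ((X.pieceAt _ _).edge_right _ _ h3)).trans h2.symm)⟩
    · rintro ⟨p, q, h, rfl, rfl⟩
      have hp := (X.pieceAt e l).edge_left _ _ h
      have hq := (X.pieceAt e l).edge_right _ _ h
      exact ⟨congrArg Subtype.val (hroot' p hp), congrArg Subtype.val (hroot' q hq), e, p, q, l,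
        hval p hp, hval q hq, h⟩

lemma decomposition_isElementary (X : Blueprint.{u} T F N) (a : Individual) :
    (X.decomposition a).IsElementary F := by
  rintro ⟨b, hv⟩ hb t ht
  obtain ⟨-, e, p, l, rfl, -⟩ := codeRole_eq_some ht
  obtain rfl : rootPos = p := (Prod.mk.inj (List.cons.inj (congrArg Subtype.val hb)).1).2
  have hval : ∀ p ∈ (X.pieceAt e l).dom, (X.place a e l p).1 = (e, p) :: l := fun p hp =>
    place_val ((X.valid_iff hv).2 hp)
  rw [piece_eq_map hv]
  have h := ((X.valid_spec hv).coreTree.map (X.place a e l) ?_).elementary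
  · rwa [show X.place a e l rootPos = ⟨(e, rootPos) :: l, hv⟩ from Subtype.ext (place_val hv)] at h
  · intro p hp q hq hpq
    have h1 := congrArg Subtype.val hpq
    rw [hval p hp, hval q hq] at h1
    exact (Prod.mk.inj (List.cons.inj h1).1).2

lemma encard_piece_le (X : Blueprint.{u} T F N) (a : Individual) (b : (X.tree a).Dom) :
    {x | (X.decomposition a).root x = b}.encard ≤ (N : ℕ∞) := by
  by_cases hex : ∃ y, (X.decomposition a).root y = b
  swap
  · have : {x | (X.decomposition a).root x = b} = ∅ :=
      Set.eq_empty_iff_forall_notMem.2 fun x hx => hex ⟨x, hx⟩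
    rw [this]
    simp
  obtain ⟨⟨y, hy⟩, rfl⟩ := hex
  cases y with
  | nil =>
    have : {x | (X.decomposition a).root x = (X.decomposition a).root ⟨[], hy⟩} ⊆
        {X.treeRoot a} := fun x hx => ((X.decomposition a).root_eq_iff x).1 hx
    refine (Set.encard_le_encard this).trans ?_
    rw [Set.encard_singleton]
    exact_mod_cast X.one_le
  | cons ep l =>
    obtain ⟨e, p⟩ := ep
    obtain ⟨s, hs, hsN⟩ := (X.valid_spec hy).card
    have : {x | (X.decomposition a).root x = (X.decomposition a).root ⟨(e, p) :: l, hy⟩} ⊆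
        X.place a e l '' s := by
      intro x hx
      obtain ⟨q, hq⟩ := exists_eq_of_codeRoot_eq (congrArg Subtype.val hx)
      have hv : X.Valid ((e, q) :: l) := hq ▸ x.2
      exact ⟨q, hs hv.2.2.2.2, Subtype.ext ((place_val hv).trans hq.symm)⟩
    refine (Set.encard_le_encard this).trans ((Set.encard_image_le _ _).trans ?_)
    rw [Set.encard_coe_eq_coe_finsetCard]
    exact_mod_cast hsN

lemma encard_incoming_le (x : (X.tree a).Dom) :
    {e : RoleName × (X.tree a).Dom | (X.tree a).rel e.1 e.2 x}.encard ≤ 2 := by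
  obtain ⟨x, hx⟩ := x
  match x, hx with
  | [], hx =>
    have : {e : RoleName × (X.tree a).Dom | (X.tree a).rel e.1 e.2 ⟨[], hx⟩} = ∅ := by
      refine Set.eq_empty_iff_forall_notMem.2 fun ⟨r, y, _⟩ h => ?_
      have h' : X.Rel r y [] := h
      cases h'
    rw [this]
    simp
  | (e, q) :: l, hx =>
    have key : ∀ r (y : (X.tree a).Dom), (X.tree a).rel r y ⟨(e, q) :: l, hx⟩ → r = e.2.1 ∧
        ((∃ p, (X.pieceAt e l).edge p q ∧ y = X.place a e l p) ∨ (y.1 = l ∧ q = rootPos)) := by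
      rintro r ⟨y, hy⟩ h
      have h' : X.Rel r y ((e, q) :: l) := h
      cases h' with
      | @inner _ p _ _ h1 h2 =>
        exact ⟨h1.symm, Or.inl ⟨p, h2, Subtype.ext (place_val hy).symm⟩⟩
      | cross h1 => exact ⟨h1.symm, Or.inr ⟨rfl, rfl⟩⟩
    by_cases hq : q = rootPos
    · subst hq
      refine le_trans (Set.encard_le_one_iff.2 ?_) one_le_two
      rintro ⟨r, y⟩ ⟨r', y'⟩ hy hy'
      obtain ⟨rfl, h⟩ := key r y hy
      obtain ⟨rfl, h'⟩ := key r' y' hy'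
      rcases h with ⟨p, h, -⟩ | ⟨h, -⟩
      · exact absurd h ((X.valid_spec hx).not_edge_root p)
      rcases h' with ⟨p, h', -⟩ | ⟨h', -⟩
      · exact absurd h' ((X.valid_spec hx).not_edge_root p)
      · exact Prod.ext rfl (Subtype.ext (h.trans h'.symm))
    · have hsub : {e' : RoleName × (X.tree a).Dom | (X.tree a).rel e'.1 e'.2 ⟨(e, q) :: l, hx⟩} ⊆
          (fun p => (e.2.1, X.place a e l p)) '' {p | (X.pieceAt e l).edge p q} := by
        rintro ⟨r, y⟩ h
        obtain ⟨rfl, ⟨p, hp, rfl⟩ | ⟨-, h⟩⟩ := key r y h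
        · exact ⟨p, hp, rfl⟩
        · exact absurd h hq
      exact (Set.encard_le_encard hsub).trans
        ((Set.encard_image_le _ _).trans ((X.valid_spec hx).into q))

lemma encard_outgoing_le (x : (X.tree a).Dom) :
    {e : RoleName × (X.tree a).Dom | (X.tree a).rel e.1 x e.2}.encard ≤ (T.exs.card + 1 : ℕ) := by
  classical
  obtain ⟨x, hx⟩ := x
  -- the edges to the child pieces for the restrictions in a given set
  let out : Finset ExData → Set (RoleName × (X.tree a).Dom) := fun s =>
    (fun e : ExData => (e.2.1, X.place a e x rootPos)) '' s
  have hout : ∀ s, (out s).encard ≤ s.card := fun s =>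
    (Set.encard_image_le _ _).trans (Set.encard_coe_eq_coe_finsetCard s).le
  have hcross : ∀ e (hv : X.Valid ((e, rootPos) :: x)),
      ((e.2.1, ⟨(e, rootPos) :: x, hv⟩) : RoleName × (X.tree a).Dom) =
        (e.2.1, X.place a e x rootPos) := fun e hv =>
    Prod.ext rfl (Subtype.ext (place_val hv).symm)
  by_cases hin : ∃ e p q l, x = (e, p) :: l ∧ (X.pieceAt e l).edge p q
  · obtain ⟨e, p, q, l, rfl, hpq⟩ := hin
    have ht := (X.valid_spec hx).transitive_of_edge _ _ hpq
    have hsub : {e' : RoleName × (X.tree a).Dom | (X.tree a).rel e'.1 ⟨(e, p) :: l, hx⟩ e'.2} ⊆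
        (fun q => (e.2.1, X.place a e l q)) '' {q | (X.pieceAt e l).edge p q} ∪
          out (T.exs.filter fun e' => ¬ e'.2.1 = e.2.1) := by
      rintro ⟨r, y, hy⟩ h
      have h' : X.Rel r ((e, p) :: l) y := h
      cases h' with
      | @inner _ _ q _ h1 h2 =>
        subst h1
        exact Or.inl ⟨q, h2, Prod.ext rfl (Subtype.ext (place_val hy))⟩
      | @cross e' _ h1 =>
        subst h1
        refine Or.inr ⟨e', ?_, (hcross e' hy).symm⟩
        refine Finset.mem_coe.2 (Finset.mem_filter.2 ⟨hy.2.1, fun he => hy.2.2.2.1 ?_⟩)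
        rw [he]
        exact codeRole_of_transitive ht p l
    refine (Set.encard_le_encard hsub).trans ((Set.encard_union_le _ _).trans ?_)
    refine (add_le_add ((Set.encard_image_le _ _).trans ((X.valid_spec hx).out p))
      (hout _)).trans ?_
    have h1 : (T.targets e.2.1).card ≤ (T.exs.filter fun e' => e'.2.1 = e.2.1).card :=
      Finset.card_image_le
    have h2 := Finset.card_filter_add_card_filter_not (s := T.exs) fun e' => e'.2.1 = e.2.1
    norm_cast
    omega
  · have hsub : {e' : RoleName × (X.tree a).Dom | (X.tree a).rel e'.1 ⟨x, hx⟩ e'.2} ⊆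
        out T.exs := by
      rintro ⟨r, y, hy⟩ h
      have h' : X.Rel r x y := h
      cases h' with
      | @inner e p q l h1 h2 => exact absurd ⟨e, p, q, l, rfl, h2⟩ hin
      | @cross e' _ h1 =>
        subst h1
        exact ⟨e', hy.2.1, (hcross e' hy).symm⟩
    refine ((Set.encard_le_encard hsub).trans (hout _)).trans ?_
    norm_cast
    omega

lemma degree_le (X : Blueprint.{u} T F N) (a : Individual) (x : (X.tree a).Dom) :
    (X.tree a).degree x ≤ (T.size : ℕ∞) := by
  have h5 := T.five_mul_card_exs_le
  rcases Nat.eq_zero_or_pos T.exs.card with h0 | hpos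
  -- without existential restrictions, the tree consists of its root
  · have hno : ∀ r (x y : (X.tree a).Dom), ¬ X.Rel r x.1 y.1 := by
      rintro r ⟨x, _⟩ ⟨y, hy⟩ h
      have h' : X.Rel r x y := h
      have hmem : ∃ e, e ∈ T.exs := by
        cases h' with
        | @inner e p q l _ _ => exact ⟨e, hy.2.1⟩
        | @cross e _ _ => exact ⟨e, hy.2.1⟩
      obtain ⟨e, he⟩ := hmem
      exact absurd he (by rw [Finset.card_eq_zero.1 h0]; exact Finset.notMem_empty e)
    simp [Interp.degree, hno]
  · refine (add_le_add (encard_outgoing_le x) (encard_incoming_le x)).trans ?_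
    norm_cast
    omega

end Blueprint

/-! ### The unravelling of the tree of pieces -/

namespace PieceDecomposition

variable {G : Interp.{u}} {g : G.Dom} {P : PieceDecomposition G g} {F : ConceptName}

lemma root_orig_of_qDom {b : G.Dom} (hb : P.root b = b) {x : QElem G.Dom}
    (hx : QDom F (P.piece b) b x) : P.root x.orig = b :=
  hx.orig_mem hb

lemma IsCopy.qDom {x : QElem G.Dom} {l : List (QElem G.Dom)} (h : P.IsCopy F (x :: l)) :
    QDom F (P.piece (P.root x.orig)) (P.root x.orig) x := by
  cases h with
  | root h => rwa [root_orig_of_qDom ((P.root_eq_iff g).2 rfl) h]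
  | child _ hc h => rwa [root_orig_of_qDom hc.1 h]

lemma IsCopy.of_qDom {x y : QElem G.Dom} {l : List (QElem G.Dom)} (h : P.IsCopy F (x :: l))
    (hy : QDom F (P.piece (P.root x.orig)) (P.root x.orig) y) : P.IsCopy F (y :: l) := by
  cases h with
  | root h => exact .root (by rwa [root_orig_of_qDom ((P.root_eq_iff g).2 rfl) h] at hy)
  | child h' hc h => exact .child h' hc (by rwa [root_orig_of_qDom hc.1 h] at hy)

end PieceDecomposition

namespace Blueprint

variable {T : TBox} {F : ConceptName} {N : ℕ} {X : Blueprint.{u} T F N} {a : Individual}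

lemma piece_not_edge_root (b p : (X.tree a).Dom) :
    ¬ ((X.decomposition a).piece b).edge p b := by
  intro h
  obtain ⟨-, hb, e, p, q, l, -, h2, h3⟩ := piece_edge_iff.1 h
  obtain ⟨b, hv⟩ := b
  obtain rfl : b = _ := h2
  obtain rfl : rootPos = q := (Prod.mk.inj (List.cons.inj hb).1).2
  exact (X.valid_spec hv).not_edge_root _ h3

lemma piece_sees {b x y : (X.tree a).Dom} {r : RoleName} (hr : codeRole b.1 = some r)
    (h : ((X.decomposition a).piece b).edge x y) : X.S.Sees r (X.label x.1) (X.label y.1) := by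
  obtain ⟨hx, -, e, p, q, l, h1, h2, h3⟩ := piece_edge_iff.1 h
  have hv : X.Valid ((e, p) :: l) := h1 ▸ x.2
  obtain ⟨-, e', p', l', hb, rfl⟩ := codeRole_eq_some hr
  rw [hb, h1] at hx
  obtain rfl := (Prod.mk.inj (List.cons.inj hx).1).1
  rw [h1, h2]
  exact (X.valid_spec hv).sees p q h3

/-- The role name of the edge that leads to a piece. -/
def inRole : Code → RoleName
  | [] => .nontrans 0
  | (e, _) :: _ => e.2.1

lemma inRole_of_codeRole {x : Code} {r : RoleName} (h : codeRole x = some r) : inRole x = r := by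
  obtain ⟨-, e, p, l, rfl, rfl⟩ := codeRole_eq_some h
  rfl

open Classical in
/-- The prescribed image of the root of a copy of the piece with root `b`, when the copy has been
added below an element with image `d`. -/
noncomputable def rootImage (X : Blueprint.{u} T F N) (d : X.I.Dom) (b : Code) : X.I.Dom :=
  if b = [] then X.start else
    if h : ∃ e, X.I.rel (inRole b) d e ∧ X.S.sim e (X.label b) then h.choose else X.label b

lemma sim_rootImage (d : X.I.Dom) (b : Code) : X.S.sim (X.rootImage d b) (X.label b) := by
  unfold rootImage
  split_ifs with h1 h2
  · subst h1
    exact X.S.equiv.refl _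
  · exact h2.choose_spec.2
  · exact X.S.equiv.refl _

/-- The homomorphism from the unravelling of the tree of pieces to the saturated model. -/
noncomputable def hom (X : Blueprint.{u} T F N) (a : Individual) :
    List (QElem (X.tree a).Dom) → X.I.Dom
  | [] => X.start
  | x :: l => image X.S (inRole x.orig.1) (fun y : (X.tree a).Dom => X.label y.1)
      ((X.decomposition a).root x.orig)
      (X.rootImage (hom X a l) (codeRoot x.orig.1)) x

lemma sim_hom (x : QElem (X.tree a).Dom) (l : List (QElem (X.tree a).Dom)) :
    X.S.sim (X.hom a (x :: l)) (X.label x.orig.1) := by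
  unfold hom
  exact sim_image (lab := fun y : (X.tree a).Dom => X.label y.1) (sim_rootImage _ _) x

lemma inRole_codeRoot (x : Code) : inRole (codeRoot x) = inRole x := by
  cases x <;> rfl

lemma role_mem_of_codeRole {x : Code} (hx : X.Valid x) {r : RoleName} (h : codeRole x = some r) :
    r ∈ T.roles := by
  obtain ⟨-, e, p, l, rfl, rfl⟩ := codeRole_eq_some h
  exact TBox.role_mem_roles hx.2.1

lemma child_eq {r : RoleName} {x b : (X.tree a).Dom} (h : (X.decomposition a).Child r x b) :
    ∃ e : ExData, e.2.1 = r ∧ b.1 = (e, rootPos) :: x.1 := by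
  obtain ⟨hb, hx, hr⟩ := h
  refine Rel.eq_codeRoot hr fun heq => hx ?_
  rw [← hb]
  exact Subtype.ext heq

lemma rel_hom {r : RoleName} {v w : List (QElem (X.tree a).Dom)}
    (h : (X.decomposition a).CopyStep F r v w) : X.I.rel r (X.hom a v) (X.hom a w) := by
  cases h with
  | @inner x y l b hb hr hxy =>
    have hx : (X.decomposition a).root x.orig = b := hxy.left
    have hy : (X.decomposition a).root y.orig = b :=
      PieceDecomposition.root_orig_of_qDom hb hxy.right
    have hx' : codeRoot x.orig.1 = b.1 := congrArg Subtype.val hx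
    have hy' : codeRoot y.orig.1 = b.1 := congrArg Subtype.val hy
    have hr' : codeRole b.1 = some r := hr
    have hrx : inRole x.orig.1 = r := by
      rw [← inRole_codeRoot, hx', inRole_of_codeRole hr']
    have hry : inRole y.orig.1 = r := by
      rw [← inRole_codeRoot, hy', inRole_of_codeRole hr']
    unfold hom
    rw [hx, hy, hx', hy', hrx, hry]
    exact rel_image X.trans (codeRole_eq_some hr').1 (role_mem_of_codeRole b.2 hr')
      (fun p q h => piece_sees hr' h) (fun p hp => hp.2) (sim_rootImage _ _) hxy
  | @cross x l b hc =>
    obtain ⟨e, rfl, hb⟩ := child_eq hc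
    have hroot : (X.decomposition a).root b = b := hc.1
    have hv : X.Valid ((e, rootPos) :: x.orig.1) := hb ▸ b.2
    have hlab : X.label b.1 = X.next e (X.label x.orig.1) := by
      rw [hb]
      exact (X.valid_spec hv).lab_root
    have hex : ∃ f, X.I.rel (inRole b.1) (X.hom a (x :: l)) f ∧ X.S.sim f (X.label b.1) := by
      have h1 := (X.next_spec e hv.2.1 _ hv.2.2.1).1
      rw [← hlab] at h1
      obtain ⟨f, hf, hbf⟩ := X.S.forth (TBox.role_mem_roles hv.2.1)
        (X.S.equiv.symm (sim_hom x l)) h1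
      refine ⟨f, ?_, X.S.equiv.symm hbf⟩
      rw [hb]
      exact hf
    have himg : X.hom a (.single b :: x :: l) = hex.choose := by
      have h1 : X.hom a (.single b :: x :: l) = X.rootImage (X.hom a (x :: l)) (codeRoot b.1) :=
        if_pos hroot.symm
      have h2 : codeRoot b.1 = b.1 := congrArg Subtype.val hroot
      have h3 : b.1 ≠ [] := by
        rw [hb]
        exact List.cons_ne_nil _ _
      rw [h1, h2, rootImage, if_neg h3, dif_pos hex]
    have hspec := hex.choose_spec.1
    rw [← himg] at hspec
    rwa [show inRole b.1 = e.2.1 by rw [hb]; rfl] at hspec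

lemma rel_hom_unravelling {r : RoleName} {v w : ((X.decomposition a).unravelling F).Dom}
    (h : ((X.decomposition a).unravelling F).rel r v w) :
    X.I.rel r (X.hom a v.1) (X.hom a w.1) := by
  unfold PieceDecomposition.unravelling at h
  dsimp only at h
  split_ifs at h with ht
  · induction h with
    | single h => exact rel_hom h
    | tail _ h ih => exact X.trans r ht _ _ _ ih (rel_hom h)
  · exact rel_hom h

lemma mem_conc_hom_iff {A : ConceptName} {v : ((X.decomposition a).unravelling F).Dom} :
    v ∈ ((X.decomposition a).unravelling F).conc A ↔ X.hom a v.1 ∈ X.I.conc A := by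
  obtain ⟨v, hv⟩ := v
  match v, hv with
  | [], hv => cases hv
  | x :: l, hv => exact (X.S.conc_iff (sim_hom x l) A).symm

/-- The unravelling has no matches of queries that have no match in the saturated model. -/
lemma satUCQ_of_unravelling {Q : UCQ} (h : ((X.decomposition a).unravelling F).SatUCQ Q) :
    X.I.SatUCQ Q := by
  obtain ⟨q, hq, π, hπ⟩ := h
  refine ⟨q, hq, fun x => X.hom a (π x).1, fun α hα => ?_⟩
  have h1 := hπ α hα
  cases α with
  | concept A x => exact mem_conc_hom_iff.1 h1
  | role r x y => exact rel_hom_unravelling h1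

/-- Existential restrictions are satisfied inside of the piece if it is over their role name, and by a
child piece otherwise. -/
lemma exists_rel_unravelling {e : ExData} (he : e ∈ T.exs)
    {v : ((X.decomposition a).unravelling F).Dom}
    (hv : v ∈ ((X.decomposition a).unravelling F).conc e.1) :
    ∃ w, ((X.decomposition a).unravelling F).rel e.2.1 v w ∧
      w ∈ ((X.decomposition a).unravelling F).conc e.2.2 := by
  obtain ⟨v, hcopy⟩ := v
  match v, hcopy, hv with
  | [], hcopy, _ => cases hcopy
  | x :: l, hcopy, hv =>
    have hvA : X.label x.orig.1 ∈ X.I.conc e.1 := hv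
    have hxv := x.orig.2
    by_cases hrole : codeRole x.orig.1 = some e.2.1
    · have ht := (codeRole_eq_some hrole).1
      obtain ⟨e', p, l', hx, he'⟩ := (codeRole_eq_some hrole).2
      rw [hx] at hxv hvA
      have hv0 : X.Valid ((e', rootPos) :: l') :=
        (X.valid_iff hxv).2 (X.valid_spec hxv).coreTree.mem_dom
      have hroot : (X.decomposition a).root x.orig = ⟨(e', rootPos) :: l', hv0⟩ :=
        Subtype.ext (by change codeRoot x.orig.1 = _; rw [hx]; rfl)
      have hseen : e.2.2 ∈ X.I.seen e'.2.1 (T.targets e'.2.1)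
          (X.lab e'.2.1 (X.next e' (X.label l')) p) := by
        rw [he']
        exact Interp.mem_seen.2 ⟨TBox.mem_targets he, by
          have := X.sat _ (TBox.mem_exs.1 he) _ hvA
          rwa [label, he'] at this⟩
      obtain ⟨q, hpq, hq⟩ := (X.valid_spec hxv).witness (he'.symm ▸ ht) p hxv.2.2.2.2 _ hseen
      have hlift : TransGen ((X.decomposition a).piece ((X.decomposition a).root x.orig)).edge
          x.orig (X.place a e' l' q) := by
        rw [hroot, piece_eq_map hv0]
        have h1 : x.orig = X.place a e' l' p := Subtype.ext (hx.trans (place_val hxv).symm)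
        rw [h1]
        exact TransGen.lift (X.place a e' l') (fun u w h => ⟨u, w, h, rfl, rfl⟩) _ _ hpq
      have hqd : q ∈ (X.pieceAt e' l').dom := by
        obtain ⟨z, -, hz⟩ := TransGen.tail'_iff.1 hpq
        exact (X.pieceAt e' l').edge_right _ _ hz
      obtain ⟨y, hy, hyq, hxy⟩ :=
        exists_qEdge (piece_not_edge_root _) hcopy.qDom hlift
      refine ⟨⟨y :: l, hcopy.of_qDom hy⟩, ?_, ?_⟩
      · have hstep : (X.decomposition a).CopyStep F e.2.1 (x :: l) (y :: l) := by
          refine .inner ((X.decomposition a).root_root _) ?_ hxy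
          change codeRole (codeRoot x.orig.1) = _
          rw [codeRole_codeRoot, hrole]
        unfold PieceDecomposition.unravelling
        dsimp only
        rw [if_pos ht]
        exact .single hstep
      · change X.label y.orig.1 ∈ X.I.conc e.2.2
        rw [hyq, place_val ((X.valid_iff hxv).2 hqd)]
        exact hq
    · have hnext := X.next_spec e he _ hvA
      have hv0 : X.Valid ((e, rootPos) :: x.orig.1) :=
        ⟨hxv, he, hvA, hrole, (X.spec _ (TBox.role_mem_roles he) _).coreTree.mem_dom⟩
      have hch : (X.decomposition a).Child e.2.1 x.orig ⟨(e, rootPos) :: x.orig.1, hv0⟩ :=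
        ⟨rfl, fun h => cons_ne_codeRoot e rootPos _ (congrArg Subtype.val h), .cross rfl⟩
      refine ⟨⟨.single ⟨(e, rootPos) :: x.orig.1, hv0⟩ :: x :: l,
        .child hcopy hch (Or.inr rfl)⟩, ?_, ?_⟩
      · have hstep := PieceDecomposition.CopyStep.cross (F := F) (l := l) hch
        unfold PieceDecomposition.unravelling
        dsimp only
        split_ifs
        · exact .single hstep
        · exact hstep
      · change X.label ((e, rootPos) :: x.orig.1) ∈ X.I.conc e.2.2
        have h1 : X.label ((e, rootPos) :: x.orig.1) = X.next e (X.label x.orig.1) :=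
          (X.valid_spec hv0).lab_root
        rw [h1]
        exact hnext.2

lemma unravelling_isModel (X : Blueprint.{u} T F N) (a : Individual) {A : ConceptName}
    (hA : X.start ∈ X.I.conc A) :
    ((X.decomposition a).unravelling F).IsModel ⟨T, {Assertion.concept A a}⟩ := by
  refine ⟨?_, ?_, ?_⟩
  · intro t ht x y z hxy hyz
    unfold PieceDecomposition.unravelling at hxy hyz ⊢
    dsimp only at hxy hyz ⊢
    rw [if_pos ht] at hxy hyz ⊢
    exact hxy.trans hyz
  · rintro (⟨L, R⟩ | ⟨B, r, C⟩ | ⟨B, r, C⟩) hc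
    · intro v hv
      obtain ⟨B, hB, hBv⟩ := X.sat _ hc (X.hom a v.1) fun B hB => mem_conc_hom_iff.1 (hv B hB)
      exact ⟨B, hB, mem_conc_hom_iff.2 hBv⟩
    · intro v hv w hvw
      exact mem_conc_hom_iff.2 (X.sat _ hc _ (mem_conc_hom_iff.1 hv) _ (rel_hom_unravelling hvw))
    · exact fun v hv => exists_rel_unravelling (e := (B, r, C)) (TBox.mem_exs.2 hc) hv
  · intro s hs
    obtain rfl := Finset.mem_singleton.1 hs
    refine ⟨⟨[.single (X.treeRoot a)], .root (Or.inr rfl)⟩, ?_, hA⟩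
    exact if_pos (if_pos rfl)

end Blueprint

lemma Interp.exists_blueprint {I : Interp.{u}} {T : TBox} {F : ConceptName}
    (S : I.Saturation T.roles F) (hI : I.IsTransitive) (hsat : ∀ c ∈ T, I.SatInclusion c)
    {A : ConceptName} {d : I.Dom} (hd : d ∈ I.conc A) {l : ℕ} (hl : 1 ≤ l)
    (hT : T.concepts.card ≤ l) : ∃ X : Blueprint.{u} T F ((l + 1) ^ (l + 1) ^ 2),
      X.start ∈ X.I.conc A ∧ ∀ Q, X.I.SatUCQ Q → I.SatUCQ Q := by
  have h1 : ∀ r d, ∃ J lab, r ∈ T.roles →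
      PieceSpec S r (T.targets r) d ((l + 1) ^ (l + 1) ^ 2) J lab := by
    intro r d
    by_cases hr : r ∈ T.roles
    · obtain ⟨J, lab, h⟩ := exists_pieceSpec S hI hr hl
        ((Finset.card_le_card (T.targets_subset r)).trans hT) d
      exact ⟨J, lab, fun _ => h⟩
    · exact ⟨core I.conc 0 fun _ => d, fun _ => d, fun h => absurd h hr⟩
  choose J lab hJ using h1
  have h2 : ∀ (e : ExData) (d : I.Dom), ∃ f, e ∈ T.exs → d ∈ I.conc e.1 →
      I.rel e.2.1 d f ∧ f ∈ I.conc e.2.2 := by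
    intro e d
    by_cases h : e ∈ T.exs ∧ d ∈ I.conc e.1
    · obtain ⟨f, hf⟩ := hsat _ (TBox.mem_exs.1 h.1) d h.2
      exact ⟨f, fun _ _ => hf⟩
    · exact ⟨d, fun h1 h2 => absurd ⟨h1, h2⟩ h⟩
  choose next hnext using h2
  exact ⟨⟨I, S, hI, hsat, d, J, lab, fun r hr d => hJ r d hr, next, fun e he d => hnext e d he,
    Nat.one_le_pow _ _ (by omega)⟩, hd, fun _ => id⟩

theorem theorem3 (T : TBox) (A : ConceptName) (a : Individual) (F : ConceptName) (Q : UCQ)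
    (h : ¬ FEntails.{u} ⟨T, {Assertion.concept A a}⟩ F Q) :
    ∃ (G : Interp.{0}) (g : G.Dom) (P : PieceDecomposition G g),
      G.ind a = some g ∧
      P.IsElementary F ∧
      (∀ b, P.root b = b → {x | P.root x = b}.encard ≤
        (((KB.mk T {Assertion.concept A a}).concepts.card + 1) ^
          (((KB.mk T {Assertion.concept A a}).concepts.card + 1) ^ 2) : ℕ)) ∧
      (∀ x, G.degree x ≤ (T.size : ℕ∞)) ∧
      (P.unravelling F).IsModel ⟨T, {Assertion.concept A a}⟩ ∧
      ¬ (P.unravelling F).SatUCQ Q := by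
  unfold FEntails at h
  push Not at h
  obtain ⟨I, hI, hF, hQ⟩ := h
  have hU := Interp.ultrapower_isModel hI
  obtain ⟨d, -, hdA⟩ := hU.2.2 _ (Finset.mem_singleton_self _)
  have hl : 1 ≤ (KB.mk T {Assertion.concept A a}).concepts.card := by
    refine Finset.card_pos.2 ⟨A, Finset.mem_union_right _ (Finset.mem_biUnion.2
      ⟨_, Finset.mem_singleton_self _, Finset.mem_singleton_self _⟩)⟩
  obtain ⟨X, hstart, hXQ⟩ := Interp.exists_blueprint
    (Interp.ultrapowerSaturation hI.1 T.roles hF) hU.1 hU.2.1 hdA hl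
    (Finset.card_le_card Finset.subset_union_left)
  exact ⟨X.tree a, X.treeRoot a, X.decomposition a, if_pos rfl, X.decomposition_isElementary a,
    fun b _ => X.encard_piece_le a b, X.degree_le a, X.unravelling_isModel a hstart, fun hsat =>
      hQ (Interp.satUCQ_of_ultrapower (hXQ Q (Blueprint.satUCQ_of_unravelling hsat)))⟩
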